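/- There exist a countable vocabulary $\tau$ containing unary predicates $X,Y$ and a binary predicate $<$, and a complete $L_{\omega_1,\omega}(\tau)$-sentence $\varphi_M$ (that is, $\varphi_M$ has a model, and for every $L_{\omega_1,\omega}(\tau)$-sentence $\psi$ either $\varphi_M\models\psi$ or $\varphi_M\models\neg\psi$), such that in every model $\mathcal M$ of $\varphi_M$ the sets $X^{\mathcal M}$ and $Y^{\mathcal M}$ partition the universe and $<^{\mathcal M}$ restricts to a strict linear order of $Y^{\mathcal M}$, and moreover: 1. $\varphi_M$ has arbitrarily large models: for every cardinal $\kappa$ there is a model $\mathcal M\models\varphi_M$ with $|\mathcal M|\ge\kappa$. 2. If $\mathcal M\models\varphi_M$, then $|\mathcal M|\le |X^{\mathcal M}|^+$. 3. For every infinite cardinal $\kappa$, $\varphi_M$ has a model of type $(\kappa^+,\kappa)$, that is, a model $\mathcal M$ with $|\mathcal M|=\kappa^+$ and $|X^{\mathcal M}|=\kappa$. -/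

import Mathlib

universe u

open Cardinal

namespace InfLogic

/-- Formulas of the infinitary logic `L_{ω₁,ω}` over the vocabulary `L` whose free variables are
among `x₀, …, x_{n-1}`: atomic formulas, implication, countable conjunctions (indexed by `ℕ`;
repetitions give the finite ones) and quantification over one variable at a time. The remaining
connectives, countable disjunctions and existential quantifiers are the usual abbreviations. -/
inductive Formula (L : FirstOrder.Language.{0, 0}) : ℕ → Type
  | falsum {n : ℕ} : Formula L n
  | equal {n : ℕ} (t₁ t₂ : L.Term (Fin n)) : Formula L n
  | rel {n l : ℕ} (R : L.Relations l) (ts : Fin l → L.Term (Fin n)) : Formula L n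
  | imp {n : ℕ} (f₁ f₂ : Formula L n) : Formula L n
  | conj {n : ℕ} (f : ℕ → Formula L n) : Formula L n
  | all {n : ℕ} (f : Formula L (n + 1)) : Formula L n

/-- Tarskian satisfaction; `v i` is the value of the variable `xᵢ`. In `all f` the new variable is
`x_n`. -/
def Formula.Realize {L : FirstOrder.Language.{0, 0}} {M : Type*} [L.Structure M] :
    {n : ℕ} → Formula L n → (Fin n → M) → Prop
  | _, .falsum, _ => False
  | _, .equal t₁ t₂, v => t₁.realize v = t₂.realize v
  | _, .rel R ts, v => FirstOrder.Language.Structure.RelMap R fun i => (ts i).realize v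
  | _, .imp f₁ f₂, v => f₁.Realize v → f₂.Realize v
  | _, .conj f, v => ∀ k, (f k).Realize v
  | n, .all f, v => ∀ a : M, f.Realize (Fin.snoc (α := fun _ : Fin (n + 1) => M) v a)

/-- Negation. -/
def Formula.neg {L : FirstOrder.Language.{0, 0}} {n : ℕ} (f : Formula L n) : Formula L n :=
  f.imp .falsum

/-- Sentences of `L_{ω₁,ω}`. -/
abbrev Sentence (L : FirstOrder.Language.{0, 0}) : Type := Formula L 0

/-- `M ⊨ φ`. -/
def Models {L : FirstOrder.Language.{0, 0}} (M : Type*) [L.Structure M] (φ : Sentence L) : Prop :=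
  φ.Realize (default : Fin 0 → M)

/-- `φ` entails `ψ` (structures are nonempty). -/
def Entails {L : FirstOrder.Language.{0, 0}} (φ ψ : Sentence L) : Prop :=
  ∀ (M : Type u) [L.Structure M] [Nonempty M], Models M φ → Models M ψ

/-- `φ` is a complete sentence of `L_{ω₁,ω}`: it has a model, and it decides every sentence of
`L_{ω₁,ω}` in its vocabulary. -/
def IsComplete {L : FirstOrder.Language.{0, 0}} (φ : Sentence L) : Prop :=
  (∃ (M : Type u) (_ : L.Structure M), Nonempty M ∧ Models M φ) ∧
    ∀ ψ : Sentence L, Entails.{u} φ ψ ∨ Entails.{u} φ ψ.neg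

/-- The interpretation `P^M` of a unary predicate. -/
def interp {L : FirstOrder.Language.{0, 0}} (P : L.Relations 1) (M : Type*) [L.Structure M] : Set M :=
  {m | FirstOrder.Language.Structure.RelMap P ![m]}

/-- `φ` has a model of type `(lam, kap)` with respect to the unary predicate `P`:
a model `M` with `|M| = lam` and `|P^M| = kap`. -/
def HasModelOfType {L : FirstOrder.Language.{0, 0}} (φ : Sentence L) (P : L.Relations 1)
    (lam kap : Cardinal.{u}) : Prop :=
  ∃ (M : Type u) (_ : L.Structure M), Nonempty M ∧ Models M φ ∧ #M = lam ∧ #(interp P M) = kap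

end InfLogic

/-! The models are generic ranked orders. Every element of the linear order `Y` has a rank in ℕ, and
an element `y` of rank `n + 1` acts as a function from `X` to the elements of rank `n` below `y`.
Genericity says that finite consistent requirements on a new element of either sort can always be
met.

Size: by `extend_X` an element `w` of rank `n + 1` maps `X` onto the elements of rank `n` below `w`.
There are countably many ranks, so every initial segment of `Y` has at most `|X|` elements
(`mk_below_le`), and a linear order with such initial segments has at most `|X|⁺` elements.

Completeness: applying an element lowers the rank, so finite sets generate finite substructures
(`exists_finite_closed`). Hence the finite partial isomorphisms between two generic models, of
whatever cardinalities, have the back-and-forth property (`forth`, `back`) and preserve all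
infinitary formulas (`realize_iff`).

Existence (`exists_generic_functions`): let `Y` be `κ⁺ × D` in lexicographic order, with `D` of size
`κ` and coloured by `κ` colours, each of them dense. The colour of `y` codes its rank and finitely
many of its values, which yields the extension property for `Y`. The other values come from an
independent family of `κ⁺` functions on `κ` points, which yields the one for `X`. -/

namespace InfLogic

/-! ### Derived connectives of the infinitary logic. -/

namespace Formula

variable {L : FirstOrder.Language.{0, 0}} {n : ℕ}

/-- Conjunction of a countable family. -/
noncomputable def iInf {ι : Type} [Countable ι] (f : ι → Formula L n) : Formula L n :=
  open Classical in
  if h : Nonempty ι then conj fun k => f ((@exists_surjective_nat ι h _).choose k) else neg falsum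

/-- The formula that is constantly true or constantly false according to `p`. -/
noncomputable def ofProp (p : Prop) : Formula L n :=
  open Classical in if p then neg falsum else falsum

/-- Conjunction of two formulas. -/
def inf (f g : Formula L n) : Formula L n := neg (imp f (neg g))

/-- Existential quantification over the last variable. -/
def ex (f : Formula L (n + 1)) : Formula L n := neg (all (neg f))

/-- Universal closure. -/
def alls : {n : ℕ} → Formula L n → Sentence L
  | 0, f => f
  | _ + 1, f => alls (all f)

variable {M : Type u} [L.Structure M] (v : Fin n → M)

@[simp] theorem realize_falsum : (falsum : Formula L n).Realize v ↔ False := Iff.rfl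

@[simp] theorem realize_imp (f g : Formula L n) :
    (imp f g).Realize v ↔ (f.Realize v → g.Realize v) := Iff.rfl

@[simp] theorem realize_all (f : Formula L (n + 1)) :
    (all f).Realize v ↔ ∀ a : M, f.Realize (Fin.snoc (α := fun _ => M) v a) := Iff.rfl

@[simp] theorem realize_neg (f : Formula L n) : f.neg.Realize v ↔ ¬ f.Realize v := Iff.rfl

@[simp] theorem realize_iInf {ι : Type} [Countable ι] (f : ι → Formula L n) :
    (iInf f).Realize v ↔ ∀ i, (f i).Realize v := by
  unfold iInf
  split_ifs with h
  · exact ((exists_surjective_nat ι).choose_spec.forall (p := fun i => (f i).Realize v)).symm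
  · simp only [realize_neg, realize_falsum, not_false_eq_true, true_iff]
    exact fun i => (h ⟨i⟩).elim

@[simp] theorem realize_ofProp (p : Prop) : (ofProp p : Formula L n).Realize v ↔ p := by
  unfold ofProp
  split_ifs with h <;> simp [h]

@[simp] theorem realize_inf (f g : Formula L n) :
    (inf f g).Realize v ↔ f.Realize v ∧ g.Realize v := by
  simp [inf]

@[simp] theorem realize_ex (f : Formula L (n + 1)) :
    (ex f).Realize v ↔ ∃ a : M, f.Realize (Fin.snoc (α := fun _ => M) v a) := by
  simp [ex]

theorem models_alls : ∀ {n : ℕ} (f : Formula L n),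
    Models M (alls f) ↔ ∀ v : Fin n → M, f.Realize v
  | 0, f => ⟨fun h v => Subsingleton.elim default v ▸ h, fun h => h _⟩
  | n + 1, f => by
    rw [alls, models_alls (all f)]
    refine ⟨fun h v => ?_, fun h v a => h _⟩
    rw [← Fin.snoc_init_self v]
    exact h _ _

end Formula

/-! ### The vocabulary and its atomic formulas. -/

/-- Relation symbols: two sorts, the ranks of the elements of the second sort, the order, and the
graph of a binary function. -/
inductive RankedRel : ℕ → Type
  | X : RankedRel 1
  | Y : RankedRel 1
  | P (n : ℕ) : RankedRel 1
  | lt : RankedRel 2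
  | R : RankedRel 3

/-- The vocabulary of ranked orders. -/
abbrev rankedLanguage : FirstOrder.Language.{0, 0} := ⟨fun _ => Empty, RankedRel⟩

instance (n : ℕ) : Countable (RankedRel n) := by
  let f : RankedRel n → ℕ := fun
    | .X => 0
    | .Y => 1
    | .lt => 2
    | .R => 3
    | .P n => n + 4
  refine Function.Injective.countable (f := f) fun a b h => ?_
  cases a <;> cases b <;> simp_all [f]

theorem countable_symbols_rankedLanguage : Countable rankedLanguage.Symbols := by
  have (l : ℕ) : Countable (rankedLanguage.Functions l) := inferInstanceAs (Countable Empty)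
  have (l : ℕ) : Countable (rankedLanguage.Relations l) := inferInstanceAs (Countable (RankedRel l))
  unfold FirstOrder.Language.Symbols
  infer_instance

section Atoms

open FirstOrder.Language

variable {M : Type u} [rankedLanguage.Structure M]

/-- Membership in the first sort. -/
def IsX (a : M) : Prop := Structure.RelMap (L := rankedLanguage) RankedRel.X ![a]

/-- Membership in the second sort. -/
def IsY (a : M) : Prop := Structure.RelMap (L := rankedLanguage) RankedRel.Y ![a]

/-- Having rank `n`. -/
def HasRank (n : ℕ) (a : M) : Prop := Structure.RelMap (L := rankedLanguage) (RankedRel.P n) ![a]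

/-- The order of the second sort. -/
def Below (a b : M) : Prop := Structure.RelMap (L := rankedLanguage) RankedRel.lt ![a, b]

/-- `Maps y x z` says that the function sends `(y, x)` to `z`. -/
def Maps (y x z : M) : Prop := Structure.RelMap (L := rankedLanguage) RankedRel.R ![y, x, z]

namespace Formula

variable {n : ℕ}

/-- Equality of variables. -/
def eqF (i j : Fin n) : Formula rankedLanguage n := equal (.var i) (.var j)

/-- Atomic formula for `IsX`. -/
def xF (i : Fin n) : Formula rankedLanguage n := rel RankedRel.X ![.var i]

/-- Atomic formula for `IsY`. -/
def yF (i : Fin n) : Formula rankedLanguage n := rel RankedRel.Y ![.var i]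

/-- Atomic formula for `HasRank`. -/
def rankF (m : ℕ) (i : Fin n) : Formula rankedLanguage n := rel (RankedRel.P m) ![.var i]

/-- Atomic formula for `Below`. -/
def ltF (i j : Fin n) : Formula rankedLanguage n := rel RankedRel.lt ![.var i, .var j]

/-- Atomic formula for `Maps`. -/
def mapsF (i j k : Fin n) : Formula rankedLanguage n := rel RankedRel.R ![.var i, .var j, .var k]

variable (v : Fin n → M)

@[simp] theorem realize_eqF (i j : Fin n) : (eqF i j).Realize v ↔ v i = v j := Iff.rfl

@[simp] theorem realize_xF (i : Fin n) : (xF i).Realize v ↔ IsX (v i) := by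
  simp only [xF, Realize, IsX]
  exact iff_of_eq (congrArg _ (by ext t; fin_cases t; rfl))

@[simp] theorem realize_yF (i : Fin n) : (yF i).Realize v ↔ IsY (v i) := by
  simp only [yF, Realize, IsY]
  exact iff_of_eq (congrArg _ (by ext t; fin_cases t; rfl))

@[simp] theorem realize_rankF (m : ℕ) (i : Fin n) : (rankF m i).Realize v ↔ HasRank m (v i) := by
  simp only [rankF, Realize, HasRank]
  exact iff_of_eq (congrArg _ (by ext t; fin_cases t; rfl))

@[simp] theorem realize_ltF (i j : Fin n) : (ltF i j).Realize v ↔ Below (v i) (v j) := by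
  simp only [ltF, Realize, Below]
  exact iff_of_eq (congrArg _ (by ext t; fin_cases t <;> rfl))

@[simp] theorem realize_mapsF (i j k : Fin n) :
    (mapsF i j k).Realize v ↔ Maps (v i) (v j) (v k) := by
  simp only [mapsF, Realize, Maps]
  exact iff_of_eq (congrArg _ (by ext t; fin_cases t <;> rfl))

end Formula

end Atoms

/-! ### Generic ranked orders and their axiomatization. -/

/-- Generic ranked orders: the second sort is a linear order divided into ranks, and each element
of rank `n + 1` sends the elements of the first sort to smaller elements of rank `n`, generically. -/
structure IsGeneric (M : Type u) [rankedLanguage.Structure M] : Prop where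
  isX_or_isY (a : M) : IsX a ∨ IsY a
  not_isY {a : M} : IsX a → ¬ IsY a
  isY_of_hasRank {n : ℕ} {a : M} : HasRank n a → IsY a
  exists_hasRank {a : M} : IsY a → ∃ n, HasRank n a
  hasRank_unique {m n : ℕ} {a : M} : HasRank m a → HasRank n a → m = n
  isY_of_below {a b : M} : Below a b → IsY a ∧ IsY b
  irrefl (a : M) : ¬ Below a a
  trans {a b c : M} : Below a b → Below b c → Below a c
  total {a b : M} : IsY a → IsY b → Below a b ∨ a = b ∨ Below b a
  isX_of_maps {y x z : M} : Maps y x z → IsX x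
  below_of_maps {y x z : M} : Maps y x z → Below z y
  hasRank_of_maps {n : ℕ} {y x z : M} : Maps y x z → (HasRank (n + 1) y ↔ HasRank n z)
  not_hasRank_zero {y x z : M} : Maps y x z → ¬ HasRank 0 y
  exists_maps {n : ℕ} {y x : M} : HasRank (n + 1) y → IsX x → ∃ z, Maps y x z
  maps_unique {y x z w : M} : Maps y x z → Maps y x w → z = w
  -- The parameter sets are finite, so each extension property is a countable conjunction of
  -- sentences. `G` is the graph of a finite part of the action of the new element.
  extend_Y (n : ℕ) (S T : Set M) (G : Set (M × M)) : S.Finite → T.Finite → G.Finite →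
    (∀ a ∈ S, IsY a) → (∀ b ∈ T, IsY b) → (∀ a ∈ S, ∀ b ∈ T, Below a b) →
    (∀ g ∈ G, IsX g.1 ∧ g.2 ∈ S ∧ ∃ m, n = m + 1 ∧ HasRank m g.2) →
    (∀ g ∈ G, ∀ h ∈ G, g.1 = h.1 → g.2 = h.2) →
    ∃ y, HasRank n y ∧ (∀ a ∈ S, Below a y) ∧ (∀ b ∈ T, Below y b) ∧
      ∀ g ∈ G, Maps y g.1 g.2
  extend_X (S : Set M) (G : Set (M × M)) : S.Finite → G.Finite →
    (∀ g ∈ G, Below g.2 g.1 ∧ ∃ m, HasRank (m + 1) g.1 ∧ HasRank m g.2) →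
    (∀ g ∈ G, ∀ h ∈ G, g.1 = h.1 → g.2 = h.2) →
    ∃ x, IsX x ∧ x ∉ S ∧ ∀ g ∈ G, Maps g.1 x g.2

namespace Formula

/-- The axioms of generic ranked orders other than the extension axioms. -/
noncomputable def baseAxioms : Sentence rankedLanguage :=
  iInf fun m : ℕ => iInf fun n : ℕ => alls (n := 4) <|
    inf (imp (neg (xF 0)) (yF 0)) <| inf (imp (xF 0) (neg (yF 0))) <|
    inf (imp (rankF n 0) (yF 0)) <| inf (imp (yF 0) (neg (iInf fun k : ℕ => neg (rankF k 0)))) <|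
    inf (imp (rankF m 0) (imp (rankF n 0) (ofProp (m = n)))) <|
    inf (imp (ltF 0 1) (inf (yF 0) (yF 1))) <| inf (neg (ltF 0 0)) <|
    inf (imp (ltF 0 1) (imp (ltF 1 2) (ltF 0 2))) <|
    inf (imp (yF 0) (imp (yF 1) (imp (neg (ltF 0 1)) (imp (neg (eqF 0 1)) (ltF 1 0))))) <|
    inf (imp (mapsF 0 1 2) (xF 1)) <| inf (imp (mapsF 0 1 2) (ltF 2 0)) <|
    inf (imp (mapsF 0 1 2) (imp (rankF (n + 1) 0) (rankF n 2))) <|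
    inf (imp (mapsF 0 1 2) (imp (rankF n 2) (rankF (n + 1) 0))) <|
    inf (imp (mapsF 0 1 2) (neg (rankF 0 0))) <|
    inf (imp (rankF (n + 1) 0) (imp (xF 1) (ex (mapsF 0 1 4)))) <|
    imp (mapsF 0 1 2) (imp (mapsF 0 1 3) (eqF 2 3))

/-- The instance of the extension axiom for the second sort with parameters `x₀, …, x_{k-1}`. -/
noncomputable def extendYAxiom (n k : ℕ) (S T : Set (Fin k)) (G : Set (Fin k × Fin k)) :
    Sentence rankedLanguage :=
  alls <| imp (iInf fun i : S => yF i.1) <| imp (iInf fun i : T => yF i.1) <|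
    imp (iInf fun i : S => iInf fun j : T => ltF i.1 j.1) <|
    imp (iInf fun g : G => inf (xF g.1.1) (inf (ofProp (g.1.2 ∈ S))
      (neg (iInf fun m : ℕ => imp (ofProp (n = m + 1)) (neg (rankF m g.1.2)))))) <|
    imp (iInf fun g : G => iInf fun h : G => imp (eqF g.1.1 h.1.1) (eqF g.1.2 h.1.2)) <|
    ex <| inf (rankF n (Fin.last k)) <| inf (iInf fun i : S => ltF i.1.castSucc (Fin.last k)) <|
      inf (iInf fun i : T => ltF (Fin.last k) i.1.castSucc) <|
      iInf fun g : G => mapsF (Fin.last k) g.1.1.castSucc g.1.2.castSucc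

/-- The instance of the extension axiom for the first sort with parameters `x₀, …, x_{k-1}`. -/
noncomputable def extendXAxiom (k : ℕ) (G : Set (Fin k × Fin k)) : Sentence rankedLanguage :=
  alls <| imp (iInf fun g : G => inf (ltF g.1.2 g.1.1)
      (neg (iInf fun m : ℕ => imp (rankF (m + 1) g.1.1) (neg (rankF m g.1.2))))) <|
    imp (iInf fun g : G => iInf fun h : G => imp (eqF g.1.1 h.1.1) (eqF g.1.2 h.1.2)) <|
    ex <| inf (xF (Fin.last k)) <| inf (iInf fun i : Fin k => neg (eqF (Fin.last k) i.castSucc)) <|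
      iInf fun g : G => mapsF g.1.1.castSucc (Fin.last k) g.1.2.castSucc

/-- The sentence that axiomatizes generic ranked orders. -/
noncomputable def genericSentence : Sentence rankedLanguage :=
  inf baseAxioms <| inf
    (iInf fun n : ℕ => iInf fun k : ℕ => iInf fun S : Set (Fin k) => iInf fun T : Set (Fin k) =>
      iInf fun G : Set (Fin k × Fin k) => extendYAxiom n k S T G)
    (iInf fun k : ℕ => iInf fun G : Set (Fin k × Fin k) => extendXAxiom k G)

variable {M : Type u} [rankedLanguage.Structure M]

theorem models_inf (f g : Sentence rankedLanguage) :
    Models M (inf f g) ↔ Models M f ∧ Models M g := realize_inf _ _ _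

theorem models_iInf {ι : Type} [Countable ι] (f : ι → Sentence rankedLanguage) :
    Models M (iInf f) ↔ ∀ i, Models M (f i) := realize_iInf _ _

theorem models_extendYAxiom (n k : ℕ) (S T : Set (Fin k)) (G : Set (Fin k × Fin k)) :
    Models M (extendYAxiom n k S T G) ↔ ∀ v : Fin k → M,
      (∀ i ∈ S, IsY (v i)) → (∀ i ∈ T, IsY (v i)) → (∀ i ∈ S, ∀ j ∈ T, Below (v i) (v j)) →
      (∀ g ∈ G, IsX (v g.1) ∧ g.2 ∈ S ∧ ∃ m, n = m + 1 ∧ HasRank m (v g.2)) →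
      (∀ g ∈ G, ∀ h ∈ G, v g.1 = v h.1 → v g.2 = v h.2) →
      ∃ y, HasRank n y ∧ (∀ i ∈ S, Below (v i) y) ∧ (∀ i ∈ T, Below y (v i)) ∧
        ∀ g ∈ G, Maps y (v g.1) (v g.2) := by
  simp only [extendYAxiom, models_alls, realize_imp, realize_iInf, realize_ex, realize_inf,
    realize_yF, realize_ltF, realize_xF, realize_ofProp, realize_neg, realize_rankF, realize_eqF,
    realize_mapsF, Fin.snoc_last, Fin.snoc_castSucc, Subtype.forall, not_forall, not_not,
    exists_prop]

theorem models_extendXAxiom (k : ℕ) (G : Set (Fin k × Fin k)) :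
    Models M (extendXAxiom k G) ↔ ∀ v : Fin k → M,
      (∀ g ∈ G, Below (v g.2) (v g.1) ∧ ∃ m, HasRank (m + 1) (v g.1) ∧ HasRank m (v g.2)) →
      (∀ g ∈ G, ∀ h ∈ G, v g.1 = v h.1 → v g.2 = v h.2) →
      ∃ x, IsX x ∧ (∀ i, x ≠ v i) ∧ ∀ g ∈ G, Maps (v g.1) x (v g.2) := by
  simp only [extendXAxiom, models_alls, realize_imp, realize_iInf, realize_ex, realize_inf,
    realize_ltF, realize_xF, realize_neg, realize_rankF, realize_eqF,
    realize_mapsF, Fin.snoc_last, Fin.snoc_castSucc, Subtype.forall, not_forall, not_not,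
    exists_prop, ne_eq]

theorem models_baseAxioms : Models M baseAxioms ↔ ∀ (m n : ℕ) (v : Fin 4 → M),
    (¬ IsX (v 0) → IsY (v 0)) ∧ (IsX (v 0) → ¬ IsY (v 0)) ∧ (HasRank n (v 0) → IsY (v 0)) ∧
    (IsY (v 0) → ∃ k, HasRank k (v 0)) ∧ (HasRank m (v 0) → HasRank n (v 0) → m = n) ∧
    (Below (v 0) (v 1) → IsY (v 0) ∧ IsY (v 1)) ∧ ¬ Below (v 0) (v 0) ∧
    (Below (v 0) (v 1) → Below (v 1) (v 2) → Below (v 0) (v 2)) ∧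
    (IsY (v 0) → IsY (v 1) → ¬ Below (v 0) (v 1) → ¬ v 0 = v 1 → Below (v 1) (v 0)) ∧
    (Maps (v 0) (v 1) (v 2) → IsX (v 1)) ∧ (Maps (v 0) (v 1) (v 2) → Below (v 2) (v 0)) ∧
    (Maps (v 0) (v 1) (v 2) → HasRank (n + 1) (v 0) → HasRank n (v 2)) ∧
    (Maps (v 0) (v 1) (v 2) → HasRank n (v 2) → HasRank (n + 1) (v 0)) ∧
    (Maps (v 0) (v 1) (v 2) → ¬ HasRank 0 (v 0)) ∧
    (HasRank (n + 1) (v 0) → IsX (v 1) → ∃ z, Maps (v 0) (v 1) z) ∧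
    (Maps (v 0) (v 1) (v 2) → Maps (v 0) (v 1) (v 3) → v 2 = v 3) := by
  have h0 (v : Fin 4 → M) (a : M) : Fin.snoc (α := fun _ => M) v a (0 : Fin 5) = v 0 := rfl
  have h1 (v : Fin 4 → M) (a : M) : Fin.snoc (α := fun _ => M) v a (1 : Fin 5) = v 1 := rfl
  have h4 (v : Fin 4 → M) (a : M) : Fin.snoc (α := fun _ => M) v a (4 : Fin 5) = a := rfl
  simp only [baseAxioms, models_iInf, models_alls, realize_imp, realize_iInf, realize_ex,
    realize_inf, realize_yF, realize_ltF, realize_xF, realize_ofProp, realize_neg, realize_rankF,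
    realize_eqF, realize_mapsF, not_forall, not_not, h0, h1, h4]

theorem models_genericSentence : Models M genericSentence ↔ IsGeneric M := by
  simp only [genericSentence, models_inf, models_iInf, models_extendYAxiom, models_extendXAxiom,
    models_baseAxioms]
  constructor
  · rintro ⟨hb, hY, hX⟩
    have hb' (m n : ℕ) (a b c d : M) := hb m n ![a, b, c, d]
    simp only [Matrix.cons_val] at hb'
    have enum (S : Set M) (hS : S.Finite) : ∃ (k : ℕ) (v : Fin k → M), ∀ a, a ∈ S ↔ ∃ i, v i = a := by
      obtain ⟨k, v, hv⟩ := hS.fin_embedding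
      exact ⟨k, v, fun a => by rw [← hv]; rfl⟩
    refine
      { isX_or_isY := fun a => or_iff_not_imp_left.2 (hb' 0 0 a a a a).1
        not_isY := fun {a} => (hb' 0 0 a a a a).2.1
        isY_of_hasRank := fun {n a} => (hb' 0 n a a a a).2.2.1
        exists_hasRank := fun {a} => (hb' 0 0 a a a a).2.2.2.1
        hasRank_unique := fun {m n a} => (hb' m n a a a a).2.2.2.2.1
        isY_of_below := fun {a b} => (hb' 0 0 a b a a).2.2.2.2.2.1
        irrefl := fun a => (hb' 0 0 a a a a).2.2.2.2.2.2.1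
        trans := fun {a b c} => (hb' 0 0 a b c a).2.2.2.2.2.2.2.1
        total := fun {a b} ha hb => ?_
        isX_of_maps := fun {a b c} => (hb' 0 0 a b c a).2.2.2.2.2.2.2.2.2.1
        below_of_maps := fun {a b c} => (hb' 0 0 a b c a).2.2.2.2.2.2.2.2.2.2.1
        hasRank_of_maps := fun {n a b c} h => ⟨(hb' 0 n a b c a).2.2.2.2.2.2.2.2.2.2.2.1 h,
          (hb' 0 n a b c a).2.2.2.2.2.2.2.2.2.2.2.2.1 h⟩
        not_hasRank_zero := fun {a b c} => (hb' 0 0 a b c a).2.2.2.2.2.2.2.2.2.2.2.2.2.1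
        exists_maps := fun {n a b} => (hb' 0 n a b a a).2.2.2.2.2.2.2.2.2.2.2.2.2.2.1
        maps_unique := fun {a b c d} => (hb' 0 0 a b c d).2.2.2.2.2.2.2.2.2.2.2.2.2.2.2
        extend_Y := fun n S T G hS hT hG h1 h2 h3 h4 h5 => ?_
        extend_X := fun S G hS hG h1 h2 => ?_ }
    · have := (hb' 0 0 a b a a).2.2.2.2.2.2.2.2.1 ha hb
      tauto
    -- The tuple `v` also lists the coordinates of the pairs in `G`; otherwise the preimage of `G`
    -- under `v` could lose requirements.
    · obtain ⟨k, v, hv⟩ := enum (S ∪ T ∪ Prod.fst '' G ∪ Prod.snd '' G)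
        (((hS.union hT).union (hG.image _)).union (hG.image _))
      have hvS {a} (ha : a ∈ S) : ∃ i, v i = a := (hv a).1 (by simp [ha])
      have hvT {a} (ha : a ∈ T) : ∃ i, v i = a := (hv a).1 (by simp [ha])
      have hvG {g} (hg : g ∈ G) : (∃ i, v i = g.1) ∧ ∃ i, v i = g.2 :=
        ⟨(hv _).1 (Or.inl (Or.inr ⟨g, hg, rfl⟩)), (hv _).1 (Or.inr ⟨g, hg, rfl⟩)⟩
      obtain ⟨y, y1, y2, y3, y4⟩ := hY n k (v ⁻¹' S) (v ⁻¹' T) {g | (v g.1, v g.2) ∈ G} v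
        (fun i hi => h1 _ hi) (fun i hi => h2 _ hi) (fun i hi j hj => h3 _ hi _ hj)
        (fun g hg => h4 _ hg) (fun g hg h hh => h5 _ hg _ hh)
      refine ⟨y, y1, fun a ha => ?_, fun a ha => ?_, fun g hg => ?_⟩
      · obtain ⟨i, rfl⟩ := hvS ha
        exact y2 i ha
      · obtain ⟨i, rfl⟩ := hvT ha
        exact y3 i ha
      · obtain ⟨⟨i, hi⟩, j, hj⟩ := hvG hg
        rw [← hi, ← hj]
        exact y4 (i, j) (by simpa [hi, hj] using hg)
    · obtain ⟨k, v, hv⟩ := enum (S ∪ Prod.fst '' G ∪ Prod.snd '' G)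
        ((hS.union (hG.image _)).union (hG.image _))
      have hvG {g} (hg : g ∈ G) : (∃ i, v i = g.1) ∧ ∃ i, v i = g.2 :=
        ⟨(hv _).1 (Or.inl (Or.inr ⟨g, hg, rfl⟩)), (hv _).1 (Or.inr ⟨g, hg, rfl⟩)⟩
      obtain ⟨x, x1, x2, x3⟩ := hX k {g | (v g.1, v g.2) ∈ G} v
        (fun g hg => h1 _ hg) (fun g hg h hh => h2 _ hg _ hh)
      refine ⟨x, x1, fun ha => ?_, fun g hg => ?_⟩
      · obtain ⟨i, hi⟩ := (hv x).1 (by simp [ha])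
        exact x2 i hi.symm
      · obtain ⟨⟨i, hi⟩, j, hj⟩ := hvG hg
        rw [← hi, ← hj]
        exact x3 (i, j) (by simpa [hi, hj] using hg)
  · intro h
    refine ⟨fun m n v => ⟨fun h' => (h.isX_or_isY _).resolve_left h', h.not_isY, h.isY_of_hasRank,
      h.exists_hasRank, h.hasRank_unique, h.isY_of_below, h.irrefl _, h.trans, fun h1 h2 h3 h4 => ?_,
      h.isX_of_maps, h.below_of_maps, fun h' => (h.hasRank_of_maps h').1,
      fun h' => (h.hasRank_of_maps h').2, h.not_hasRank_zero, h.exists_maps, h.maps_unique⟩,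
      fun n k S T G v h1 h2 h3 h4 h5 => ?_, fun k G v h1 h2 => ?_⟩
    · have := h.total h1 h2
      tauto
    · obtain ⟨y, y1, y2, y3, y4⟩ := h.extend_Y n (v '' S) (v '' T) (Prod.map v v '' G)
        (Set.toFinite _) (Set.toFinite _) (Set.toFinite _)
        (by rintro _ ⟨i, hi, rfl⟩; exact h1 i hi) (by rintro _ ⟨i, hi, rfl⟩; exact h2 i hi)
        (by rintro _ ⟨i, hi, rfl⟩ _ ⟨j, hj, rfl⟩; exact h3 i hi j hj)
        (by rintro _ ⟨g, hg, rfl⟩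
            exact ⟨(h4 g hg).1, ⟨_, (h4 g hg).2.1, rfl⟩, (h4 g hg).2.2⟩)
        (by rintro _ ⟨g, hg, rfl⟩ _ ⟨g', hg', rfl⟩; exact h5 g hg g' hg')
      exact ⟨y, y1, fun i hi => y2 _ ⟨i, hi, rfl⟩, fun i hi => y3 _ ⟨i, hi, rfl⟩,
        fun g hg => y4 _ ⟨g, hg, rfl⟩⟩
    · obtain ⟨x, x1, x2, x3⟩ := h.extend_X (Set.range v) (Prod.map v v '' G)
        (Set.toFinite _) (Set.toFinite _) (by rintro _ ⟨g, hg, rfl⟩; exact h1 g hg)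
        (by rintro _ ⟨g, hg, rfl⟩ _ ⟨g', hg', rfl⟩; exact h2 g hg g' hg')
      exact ⟨x, x1, fun i hi => x2 ⟨i, hi.symm⟩, fun g hg => x3 _ ⟨g, hg, rfl⟩⟩

end Formula

/-! ### Finite generation. -/

variable {M N : Type u} [rankedLanguage.Structure M] [rankedLanguage.Structure N]

namespace IsGeneric

theorem isX_iff_not_isY (hM : IsGeneric M) {a : M} : IsX a ↔ ¬ IsY a :=
  ⟨hM.not_isY, (hM.isX_or_isY a).resolve_right⟩

theorem exists_hasRank_of_maps (hM : IsGeneric M) {y x z : M} (h : Maps y x z) :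
    ∃ n, HasRank (n + 1) y ∧ HasRank n z := by
  obtain ⟨n, hn⟩ := hM.exists_hasRank (hM.isY_of_below (hM.below_of_maps h)).1
  exact ⟨n, (hM.hasRank_of_maps h).2 hn, hn⟩

theorem isY_left_of_maps (hM : IsGeneric M) {y x z : M} (h : Maps y x z) : IsY y :=
  (hM.isY_of_below (hM.below_of_maps h)).2

theorem isY_right_of_maps (hM : IsGeneric M) {y x z : M} (h : Maps y x z) : IsY z :=
  (hM.isY_of_below (hM.below_of_maps h)).1

/-- Finitely many elements of the first sort generate a finite set from an element of the second
sort. -/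
theorem exists_finite_closed (hM : IsGeneric M) {A : Set M} (hA : A.Finite) {y : M} (hy : IsY y) :
    ∃ T : Set M, T.Finite ∧ y ∈ T ∧ (∀ t ∈ T, IsY t) ∧
      ∀ t ∈ T, ∀ x ∈ A, ∀ z, Maps t x z → z ∈ T := by
  obtain ⟨n, hn⟩ := hM.exists_hasRank hy
  clear hy
  -- Each application lowers the rank by one, so the tree of iterated values of `y` has depth at
  -- most `n` and finite branching.
  induction n generalizing y with
  | zero =>
    exact ⟨{y}, Set.finite_singleton y, rfl, by rintro _ rfl; exact hM.isY_of_hasRank hn,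
      by rintro _ rfl x - z h; exact (hM.not_hasRank_zero h hn).elim⟩
  | succ n ih =>
    have key (x : M) : ∃ T : Set M, T.Finite ∧ (∀ z, Maps y x z → z ∈ T) ∧ (∀ t ∈ T, IsY t) ∧
        ∀ t ∈ T, ∀ x ∈ A, ∀ z, Maps t x z → z ∈ T := by
      by_cases h : ∃ z, Maps y x z
      · obtain ⟨z, hz⟩ := h
        obtain ⟨T, h1, h2, h3⟩ := ih ((hM.hasRank_of_maps hz).1 hn)
        exact ⟨T, h1, fun w hw => hM.maps_unique hz hw ▸ h2, h3⟩
      · exact ⟨∅, Set.finite_empty, fun z hz => (h ⟨z, hz⟩).elim, by simp, by simp⟩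
    choose T h1 h2 h3 h4 using key
    refine ⟨insert y (⋃ x ∈ A, T x), (hA.biUnion fun x _ => h1 x).insert y, Set.mem_insert _ _,
      ?_, ?_⟩
    · simp only [Set.mem_insert_iff, Set.mem_iUnion, exists_prop]
      rintro t (rfl | ⟨x, -, ht⟩)
      exacts [hM.isY_of_hasRank hn, h3 x t ht]
    · simp only [Set.mem_insert_iff, Set.mem_iUnion, exists_prop]
      rintro t (rfl | ⟨x, hx, ht⟩) x' hx' z hz
      exacts [Or.inr ⟨x', hx', h2 _ _ hz⟩, Or.inr ⟨x, hx, h4 x t ht x' hx' z hz⟩]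

/-- Version of `exists_finite_closed` for finitely many elements of the second sort. -/
theorem exists_finite_closed_superset (hM : IsGeneric M) {A B : Set M} (hA : A.Finite)
    (hB : B.Finite) (hBY : ∀ y ∈ B, IsY y) :
    ∃ T : Set M, T.Finite ∧ B ⊆ T ∧ (∀ t ∈ T, IsY t) ∧
      ∀ t ∈ T, ∀ x ∈ A, ∀ z, Maps t x z → z ∈ T := by
  choose! T h1 h2 h3 h4 using fun y (hy : y ∈ B) => hM.exists_finite_closed hA (hBY y hy)
  refine ⟨⋃ y ∈ B, T y, hB.biUnion h1, fun y hy => Set.mem_biUnion hy (h2 y hy), ?_, ?_⟩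
  · simp only [Set.mem_iUnion, exists_prop]
    rintro t ⟨y, hy, ht⟩
    exact h3 y hy t ht
  · simp only [Set.mem_iUnion, exists_prop]
    rintro t ⟨y, hy, ht⟩ x hx z hz
    exact ⟨y, hy, h4 y hy t ht x hx z hz⟩

end IsGeneric

/-! ### Back and forth between generic ranked orders. -/

/-- Isomorphisms between substructures, as sets of pairs. -/
structure IsPartialIso (p : Set (M × N)) : Prop where
  eq_iff {a b} : a ∈ p → b ∈ p → (a.1 = b.1 ↔ a.2 = b.2)
  isX_iff {a} : a ∈ p → (IsX a.1 ↔ IsX a.2)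
  hasRank_iff {a} (n : ℕ) : a ∈ p → (HasRank n a.1 ↔ HasRank n a.2)
  below_iff {a b} : a ∈ p → b ∈ p → (Below a.1 b.1 ↔ Below a.2 b.2)
  maps_iff {a b c} : a ∈ p → b ∈ p → c ∈ p → (Maps a.1 b.1 c.1 ↔ Maps a.2 b.2 c.2)
  closed {a b z} : a ∈ p → b ∈ p → Maps a.1 b.1 z → z ∈ Prod.fst '' p

namespace IsPartialIso

variable {p : Set (M × N)}

theorem empty : IsPartialIso (∅ : Set (M × N)) := by
  constructor <;> simp

theorem isY_iff (hM : IsGeneric M) (hN : IsGeneric N) (hp : IsPartialIso p) {a} (ha : a ∈ p) :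
    IsY a.1 ↔ IsY a.2 := by
  have := hp.isX_iff ha
  rw [hM.isX_iff_not_isY, hN.isX_iff_not_isY] at this
  exact not_iff_not.1 this

/-- The rank decides whether an element acts, so the corresponding value exists in `M` and lies in
the domain; by uniqueness its partner is `z`. This makes the one-sided field `closed` symmetric. -/
theorem closed_right (hM : IsGeneric M) (hN : IsGeneric N) (hp : IsPartialIso p) {a b z}
    (ha : a ∈ p) (hb : b ∈ p) (h : Maps a.2 b.2 z) : z ∈ Prod.snd '' p := by
  obtain ⟨n, hn, -⟩ := hN.exists_hasRank_of_maps h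
  obtain ⟨w, hw⟩ := hM.exists_maps ((hp.hasRank_iff _ ha).2 hn)
    ((hp.isX_iff hb).2 (hN.isX_of_maps h))
  obtain ⟨c, hc, rfl⟩ := hp.closed ha hb hw
  exact ⟨c, hc, hN.maps_unique ((hp.maps_iff ha hb hc).1 hw) h⟩

theorem swap (hM : IsGeneric M) (hN : IsGeneric N) (hp : IsPartialIso p) :
    IsPartialIso (Prod.swap '' p) := by
  have mem {a : N × M} (ha : a ∈ Prod.swap '' p) : a.swap ∈ p := by
    obtain ⟨b, hb, rfl⟩ := ha
    exact hb
  refine ⟨fun ha hb => (hp.eq_iff (mem ha) (mem hb)).symm, fun ha => (hp.isX_iff (mem ha)).symm,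
    fun n ha => (hp.hasRank_iff n (mem ha)).symm,
    fun ha hb => (hp.below_iff (mem ha) (mem hb)).symm,
    fun ha hb hc => (hp.maps_iff (mem ha) (mem hb) (mem hc)).symm, fun ha hb hz => ?_⟩
  obtain ⟨c, hc, rfl⟩ := hp.closed_right hM hN (mem ha) (mem hb) hz
  exact ⟨_, ⟨c, hc, rfl⟩, rfl⟩

/-- Extension by an element of the second sort whose images lie in the domain. -/
theorem exists_insert_isY (hM : IsGeneric M) (hN : IsGeneric N) (hp : IsPartialIso p)
    (hfin : p.Finite) {y : M} (hy : IsY y) (hyp : y ∉ Prod.fst '' p)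
    (hcl : ∀ b ∈ p, ∀ z, Maps y b.1 z → z ∈ Prod.fst '' p) :
    ∃ y', IsPartialIso (insert (y, y') p) := by
  obtain ⟨n, hn⟩ := hM.exists_hasRank hy
  -- The requirements on `y'` are the images of the cut that `y` makes in the domain and of the
  -- graph of `y` on the domain.
  obtain ⟨y', h1, h2, h3, h4⟩ := hN.extend_Y n (Prod.snd '' {a ∈ p | Below a.1 y})
    (Prod.snd '' {a ∈ p | Below y a.1})
    ((fun q : (M × N) × (M × N) => (q.1.2, q.2.2)) ''
      {q | q.1 ∈ p ∧ q.2 ∈ p ∧ Maps y q.1.1 q.2.1})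
    ((hfin.subset (Set.sep_subset _ _)).image _) ((hfin.subset (Set.sep_subset _ _)).image _)
    (((hfin.prod hfin).subset fun q hq => ⟨hq.1, hq.2.1⟩).image _)
    (by rintro _ ⟨a, ⟨ha, hay⟩, rfl⟩
        exact (hp.isY_iff hM hN ha).1 (hM.isY_of_below hay).1)
    (by rintro _ ⟨a, ⟨ha, hay⟩, rfl⟩
        exact (hp.isY_iff hM hN ha).1 (hM.isY_of_below hay).2)
    (by rintro _ ⟨a, ⟨ha, hay⟩, rfl⟩ _ ⟨b, ⟨hb, hby⟩, rfl⟩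
        exact (hp.below_iff ha hb).1 (hM.trans hay hby))
    (by rintro _ ⟨⟨a, b⟩, ⟨ha, hb, hab⟩, rfl⟩
        obtain ⟨m, hm, hm'⟩ := hM.exists_hasRank_of_maps hab
        exact ⟨(hp.isX_iff ha).1 (hM.isX_of_maps hab), ⟨b, ⟨hb, hM.below_of_maps hab⟩, rfl⟩,
          m, hM.hasRank_unique hn hm, (hp.hasRank_iff m hb).1 hm'⟩)
    (by rintro _ ⟨⟨a, b⟩, ⟨ha, hb, hab⟩, rfl⟩ _ ⟨⟨c, d⟩, ⟨hc, hd, hcd⟩, rfl⟩ h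
        dsimp only at *
        rw [← hp.eq_iff ha hc] at h
        rw [← hp.eq_iff hb hd]
        exact hM.maps_unique hab (h ▸ hcd))
  have hy' := hN.isY_of_hasRank h1
  have b1 {a} (ha : a ∈ p) (h : Below a.1 y) : Below a.2 y' := h2 _ ⟨a, ⟨ha, h⟩, rfl⟩
  have b2 {a} (ha : a ∈ p) (h : Below y a.1) : Below y' a.2 := h3 _ ⟨a, ⟨ha, h⟩, rfl⟩
  -- As `y` is not in the domain, it is strictly comparable with every element of `Y` there; this
  -- turns `b1` and `b2` into equivalences.
  have tri {a} (ha : a ∈ p) (hY : IsY a.2) : Below a.1 y ∨ Below y a.1 := by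
    rcases hM.total ((hp.isY_iff hM hN ha).2 hY) hy with h | h | h
    exacts [Or.inl h, (hyp ⟨a, ha, h⟩).elim, Or.inr h]
  have b1' {a} (ha : a ∈ p) (h : Below a.2 y') : Below a.1 y := by
    rcases tri ha (hN.isY_of_below h).1 with h' | h'
    exacts [h', (hN.irrefl _ (hN.trans h (b2 ha h'))).elim]
  have b2' {a} (ha : a ∈ p) (h : Below y' a.2) : Below y a.1 := by
    rcases tri ha (hN.isY_of_below h).2 with h' | h'
    exacts [(hN.irrefl _ (hN.trans h (b1 ha h'))).elim, h']
  have hyp' : y' ∉ Prod.snd '' p := by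
    rintro ⟨a, ha, rfl⟩
    rcases tri ha hy' with h | h
    exacts [hN.irrefl _ (b1 ha h), hN.irrefl _ (b2 ha h)]
  have m1 {a b} (ha : a ∈ p) (hb : b ∈ p) (h : Maps y a.1 b.1) : Maps y' a.2 b.2 :=
    h4 (a.2, b.2) ⟨(a, b), ⟨ha, hb, h⟩, rfl⟩
  -- The value of `y` at `a.1` exists by rank and lies in the domain by `hcl`; `m1` sends it to the
  -- value of `y'` at `a.2`, which is `b.2`.
  have m1' {a b} (ha : a ∈ p) (hb : b ∈ p) (h : Maps y' a.2 b.2) : Maps y a.1 b.1 := by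
    obtain ⟨m, hm, -⟩ := hN.exists_hasRank_of_maps h
    obtain ⟨z, hz⟩ := hM.exists_maps (hN.hasRank_unique h1 hm ▸ hn)
      ((hp.isX_iff ha).2 (hN.isX_of_maps h))
    obtain ⟨c, hc, rfl⟩ := hcl a ha z hz
    rwa [(hp.eq_iff hb hc).2 (hN.maps_unique h (m1 ha hc hz))]
  have mX {z w : M} (h : Maps z y w) : False := hM.not_isY (hM.isX_of_maps h) hy
  have mX' {z w : N} (h : Maps z y' w) : False := hN.not_isY (hN.isX_of_maps h) hy'
  have mS {x : M} (h : Maps y x y) : False := hM.irrefl _ (hM.below_of_maps h)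
  have mS' {x : N} (h : Maps y' x y') : False := hN.irrefl _ (hN.below_of_maps h)
  refine ⟨y', ?_, ?_, ?_, ?_, ?_, ?_⟩
  · rintro a b (rfl | ha) (rfl | hb)
    · simp
    · exact iff_of_false (fun h => hyp ⟨b, hb, h.symm⟩) fun h => hyp' ⟨b, hb, h.symm⟩
    · exact iff_of_false (fun h => hyp ⟨a, ha, h⟩) fun h => hyp' ⟨a, ha, h⟩
    · exact hp.eq_iff ha hb
  · rintro a (rfl | ha)
    · exact iff_of_false (fun h => hM.not_isY h hy) fun h => hN.not_isY h hy'
    · exact hp.isX_iff ha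
  · rintro a m (rfl | ha)
    · exact ⟨fun h => hM.hasRank_unique hn h ▸ h1, fun h => hN.hasRank_unique h1 h ▸ hn⟩
    · exact hp.hasRank_iff m ha
  · rintro a b (rfl | ha) (rfl | hb)
    · exact iff_of_false (hM.irrefl _) (hN.irrefl _)
    · exact ⟨b2 hb, b2' hb⟩
    · exact ⟨b1 ha, b1' ha⟩
    · exact hp.below_iff ha hb
  · rintro a b c ha (rfl | hb) hc
    · exact iff_of_false mX mX'
    obtain rfl | ha := ha <;> obtain rfl | hc := hc
    · exact iff_of_false mS mS'
    · exact ⟨m1 hb hc, m1' hb hc⟩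
    · refine iff_of_false (fun h => hyp (hp.closed ha hb h))
        fun h => hyp' (hp.closed_right hM hN ha hb h)
    · exact hp.maps_iff ha hb hc
  · rintro a b z (rfl | ha) (rfl | hb) h
    · exact (mX h).elim
    · exact Set.image_mono (Set.subset_insert _ _) (hcl b hb z h)
    · exact (mX h).elim
    · exact Set.image_mono (Set.subset_insert _ _) (hp.closed ha hb h)

/-- Extension by an element of the first sort that maps the domain to itself. -/
theorem exists_insert_isX (hM : IsGeneric M) (hN : IsGeneric N) (hp : IsPartialIso p)
    (hfin : p.Finite) {x : M} (hx : IsX x) (hxp : x ∉ Prod.fst '' p)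
    (hcl : ∀ b ∈ p, ∀ z, Maps b.1 x z → z ∈ Prod.fst '' p) :
    ∃ x', IsPartialIso (insert (x, x') p) := by
  -- Elements of `X` carry no order, so the only requirements are that `x'` be new and that the
  -- domain act on it as on `x`.
  obtain ⟨x', hx', hxp', h4⟩ := hN.extend_X (Prod.snd '' p)
    ((fun q : (M × N) × (M × N) => (q.1.2, q.2.2)) ''
      {q | q.1 ∈ p ∧ q.2 ∈ p ∧ Maps q.1.1 x q.2.1}) (hfin.image _)
    (((hfin.prod hfin).subset fun q hq => ⟨hq.1, hq.2.1⟩).image _)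
    (by rintro _ ⟨⟨a, b⟩, ⟨ha, hb, hab⟩, rfl⟩
        obtain ⟨m, hm, hm'⟩ := hM.exists_hasRank_of_maps hab
        exact ⟨(hp.below_iff hb ha).1 (hM.below_of_maps hab), m, (hp.hasRank_iff _ ha).1 hm,
          (hp.hasRank_iff m hb).1 hm'⟩)
    (by rintro _ ⟨⟨a, b⟩, ⟨ha, hb, hab⟩, rfl⟩ _ ⟨⟨c, d⟩, ⟨hc, hd, hcd⟩, rfl⟩ h
        dsimp only at *
        rw [← hp.eq_iff ha hc] at h
        rw [← hp.eq_iff hb hd]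
        exact hM.maps_unique hab (h ▸ hcd))
  have m1 {a b} (ha : a ∈ p) (hb : b ∈ p) (h : Maps a.1 x b.1) : Maps a.2 x' b.2 :=
    h4 (a.2, b.2) ⟨(a, b), ⟨ha, hb, h⟩, rfl⟩
  have m1' {a b} (ha : a ∈ p) (hb : b ∈ p) (h : Maps a.2 x' b.2) : Maps a.1 x b.1 := by
    obtain ⟨m, hm, -⟩ := hN.exists_hasRank_of_maps h
    obtain ⟨z, hz⟩ := hM.exists_maps ((hp.hasRank_iff _ ha).2 hm) hx
    obtain ⟨c, hc, rfl⟩ := hcl a ha z hz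
    rwa [(hp.eq_iff hb hc).2 (hN.maps_unique h (m1 ha hc hz))]
  have nY := hM.not_isY hx
  have nY' := hN.not_isY hx'
  refine ⟨x', ?_, ?_, ?_, ?_, ?_, ?_⟩
  · rintro a b (rfl | ha) (rfl | hb)
    · simp
    · exact iff_of_false (fun h => hxp ⟨b, hb, h.symm⟩) fun h => hxp' ⟨b, hb, h.symm⟩
    · exact iff_of_false (fun h => hxp ⟨a, ha, h⟩) fun h => hxp' ⟨a, ha, h⟩
    · exact hp.eq_iff ha hb
  · rintro a (rfl | ha)
    · exact iff_of_true hx hx'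
    · exact hp.isX_iff ha
  · rintro a m (rfl | ha)
    · exact iff_of_false (fun h => nY (hM.isY_of_hasRank h)) fun h => nY' (hN.isY_of_hasRank h)
    · exact hp.hasRank_iff m ha
  · rintro a b (rfl | ha) hb
    · exact iff_of_false (fun h => nY (hM.isY_of_below h).1) fun h => nY' (hN.isY_of_below h).1
    obtain rfl | hb := hb
    · exact iff_of_false (fun h => nY (hM.isY_of_below h).2) fun h => nY' (hN.isY_of_below h).2
    · exact hp.below_iff ha hb
  · rintro a b c (rfl | ha) hb hc
    · exact iff_of_false (fun h => nY (hM.isY_left_of_maps h))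
        fun h => nY' (hN.isY_left_of_maps h)
    obtain rfl | hc := hc
    · exact iff_of_false (fun h => nY (hM.isY_right_of_maps h))
        fun h => nY' (hN.isY_right_of_maps h)
    obtain rfl | hb := hb
    · exact ⟨m1 ha hc, m1' ha hc⟩
    · exact hp.maps_iff ha hb hc
  · rintro a b z (rfl | ha) hb h
    · exact (nY (hM.isY_left_of_maps h)).elim
    obtain rfl | hb := hb
    · exact Set.image_mono (Set.subset_insert _ _) (hcl a ha z h)
    · exact Set.image_mono (Set.subset_insert _ _) (hp.closed ha hb h)

/-- Extension by a finite set of elements of the second sort that is closed under the elements of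
the first sort in the domain. -/
theorem exists_superset_of_closed (hM : IsGeneric M) (hN : IsGeneric N) (hp : IsPartialIso p)
    (hfin : p.Finite) {T : Set M} (hT : T.Finite) (hTY : ∀ t ∈ T, IsY t)
    (hcl : ∀ t ∈ T, ∀ b ∈ p, ∀ z, Maps t b.1 z → z ∈ T) :
    ∃ q, IsPartialIso q ∧ q.Finite ∧ p ⊆ q ∧ Prod.fst '' q = Prod.fst '' p ∪ T := by
  obtain ⟨k, hk⟩ : ∃ k, (T \ Prod.fst '' p).ncard = k := ⟨_, rfl⟩
  induction k generalizing p with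
  | zero =>
    rw [Set.ncard_eq_zero (hT.subset Set.sdiff_subset), Set.sdiff_eq_empty] at hk
    exact ⟨p, hp, hfin, subset_rfl, (Set.union_eq_left.2 hk).symm⟩
  | succ k ih =>
    have hne : (T \ Prod.fst '' p).Nonempty := by
      rw [Set.nonempty_iff_ne_empty]
      intro h
      simp [h] at hk
    have hex : ∃ n, ∃ t ∈ T \ Prod.fst '' p, HasRank n t := by
      obtain ⟨t, ht⟩ := hne
      obtain ⟨n, hn⟩ := hM.exists_hasRank (hTY t ht.1)
      exact ⟨n, t, ht, hn⟩
    classical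
    -- Take a missing element of least rank: its values lie in `T` and have smaller rank, so they
    -- are already in the domain.
    obtain ⟨t, ht, htn⟩ := Nat.find_spec hex
    obtain ⟨t', ht'⟩ := hp.exists_insert_isY hM hN hfin (hTY t ht.1) ht.2 fun b hb z hz => by
      by_contra hzp
      obtain ⟨m, hm, hm'⟩ := hM.exists_hasRank_of_maps hz
      refine Nat.find_min hex (m := m) ?_ ⟨z, ⟨hcl t ht.1 b hb z hz, hzp⟩, hm'⟩
      rw [hM.hasRank_unique htn hm]
      exact m.lt_succ_self
    obtain ⟨q, h1, h2, h3, h4⟩ := ih ht' (hfin.insert _) (by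
      rintro s hs b (rfl | hb) z hz
      exacts [(hM.not_isY (hM.isX_of_maps hz) (hTY t ht.1)).elim, hcl s hs b hb z hz]) (by
      have : T \ Prod.fst '' insert (t, t') p = (T \ Prod.fst '' p) \ {t} := by
        rw [Set.image_insert_eq, Set.sdiff_sdiff, Set.union_comm, Set.singleton_union]
      rw [this, Set.ncard_sdiff_singleton_of_mem ht, hk]
      rfl)
    refine ⟨q, h1, h2, (Set.subset_insert _ _).trans h3, ?_⟩
    rw [h4, Set.image_insert_eq, Set.insert_union]
    exact Set.insert_eq_of_mem (Or.inr ht.1)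

/-- The forth step. -/
theorem forth (hM : IsGeneric M) (hN : IsGeneric N) (hp : IsPartialIso p) (hfin : p.Finite)
    (a : M) : ∃ q, IsPartialIso q ∧ q.Finite ∧ p ⊆ q ∧ a ∈ Prod.fst '' q := by
  rcases hM.isX_or_isY a with ha | ha
  · by_cases hap : a ∈ Prod.fst '' p
    · exact ⟨p, hp, hfin, subset_rfl, hap⟩
    -- The `Y`-part of the domain is first closed under `a` as well as the old elements of `X`; then
    -- adding `a` creates no value outside the domain.
    obtain ⟨T, hT, hBT, hTY, hcl⟩ := hM.exists_finite_closed_superset (A := insert a (Prod.fst '' p))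
      (B := {y ∈ Prod.fst '' p | IsY y}) ((hfin.image _).insert a)
      ((hfin.image _).subset (Set.sep_subset _ _)) fun y hy => hy.2
    obtain ⟨q, h1, h2, h3, h4⟩ := hp.exists_superset_of_closed hM hN hfin hT hTY
      fun t ht b hb z hz => hcl t ht b.1 (Or.inr ⟨b, hb, rfl⟩) z hz
    obtain ⟨a', ha'⟩ := h1.exists_insert_isX hM hN h2 ha
      (by rw [h4]
          rintro (h | h)
          exacts [hap h, hM.not_isY ha (hTY a h)])
      (fun b hb z hz => by
        have hb1 : b.1 ∈ Prod.fst '' q := ⟨b, hb, rfl⟩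
        rw [h4] at hb1 ⊢
        have hbT : b.1 ∈ T := hb1.elim (fun h => hBT ⟨h, hM.isY_left_of_maps hz⟩) id
        exact Or.inr (hcl _ hbT a (Or.inl rfl) z hz))
    exact ⟨_, ha', h2.insert _, h3.trans (Set.subset_insert _ _), ⟨_, Set.mem_insert _ _, rfl⟩⟩
  · obtain ⟨T, hT, haT, hTY, hcl⟩ := hM.exists_finite_closed (hfin.image Prod.fst) ha
    obtain ⟨q, h1, h2, h3, h4⟩ := hp.exists_superset_of_closed hM hN hfin hT hTY
      fun t ht b hb z hz => hcl t ht b.1 ⟨b, hb, rfl⟩ z hz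
    exact ⟨q, h1, h2, h3, h4 ▸ Or.inr haT⟩

/-- The back step. -/
theorem back (hM : IsGeneric M) (hN : IsGeneric N) (hp : IsPartialIso p) (hfin : p.Finite)
    (b : N) : ∃ q, IsPartialIso q ∧ q.Finite ∧ p ⊆ q ∧ b ∈ Prod.snd '' q := by
  obtain ⟨q, h1, h2, h3, c, hc, rfl⟩ := (hp.swap hM hN).forth hN hM (hfin.image _) b
  exact ⟨Prod.swap '' q, h1.swap hN hM, h2.image _,
    fun a ha => ⟨a.swap, h3 ⟨a, ha, rfl⟩, a.swap_swap⟩, ⟨c.swap, ⟨c, hc, rfl⟩, rfl⟩⟩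

/-- Finite partial isomorphisms preserve all formulas. -/
theorem realize_iff (hM : IsGeneric M) (hN : IsGeneric N) {n : ℕ} (f : Formula rankedLanguage n)
    (hp : IsPartialIso p) (hfin : p.Finite) (v : Fin n → M) (w : Fin n → N)
    (hvw : ∀ i, (v i, w i) ∈ p) : f.Realize v ↔ f.Realize w := by
  induction f generalizing p with
  | falsum => exact Iff.rfl
  | equal t s =>
    cases t with
    | func f _ => exact f.elim
    | var i =>
      cases s with
      | func f _ => exact f.elim
      | var j => exact hp.eq_iff (hvw i) (hvw j)
  | @rel n l r ts =>
    -- Without function symbols every term is a variable.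
    have hts : ∃ g : Fin l → Fin n, ts = fun i => .var (g i) := by
      have (i : Fin l) : ∃ j, ts i = .var j := by
        cases ts i with
        | func f _ => exact f.elim
        | var j => exact ⟨j, rfl⟩
      choose g hg using this
      exact ⟨g, funext hg⟩
    obtain ⟨g, rfl⟩ := hts
    have e1 {α : Type u} (h : Fin 1 → α) : h = ![h 0] := by ext i; fin_cases i; rfl
    have e2 {α : Type u} (h : Fin 2 → α) : h = ![h 0, h 1] := by ext i; fin_cases i <;> rfl
    have e3 {α : Type u} (h : Fin 3 → α) : h = ![h 0, h 1, h 2] := by ext i; fin_cases i <;> rfl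
    simp only [Formula.Realize, FirstOrder.Language.Term.realize_var]
    cases r with
    | X =>
      rw [e1 (fun i => v (g i)), e1 (fun i => w (g i))]
      exact hp.isX_iff (hvw _)
    | Y =>
      rw [e1 (fun i => v (g i)), e1 (fun i => w (g i))]
      exact hp.isY_iff hM hN (hvw _)
    | P m =>
      rw [e1 (fun i => v (g i)), e1 (fun i => w (g i))]
      exact hp.hasRank_iff m (hvw _)
    | lt =>
      rw [e2 (fun i => v (g i)), e2 (fun i => w (g i))]
      exact hp.below_iff (hvw _) (hvw _)
    | R =>
      rw [e3 (fun i => v (g i)), e3 (fun i => w (g i))]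
      exact hp.maps_iff (hvw _) (hvw _) (hvw _)
  | imp f g ihf ihg => exact imp_congr (ihf hp hfin v w hvw) (ihg hp hfin v w hvw)
  | conj f ih => exact forall_congr' fun k => ih k hp hfin v w hvw
  | @all n f ih =>
    have snoc_mem {q : Set (M × N)} (hpq : p ⊆ q) {c : M × N} (hc : c ∈ q) (i : Fin (n + 1)) :
        (Fin.snoc (α := fun _ => M) v c.1 i, Fin.snoc (α := fun _ => N) w c.2 i) ∈ q := by
      refine Fin.lastCases ?_ (fun i => ?_) i
      · simpa using hc
      · simpa using hpq (hvw i)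
    constructor
    · intro h b
      obtain ⟨q, h1, h2, h3, c, hc, rfl⟩ := hp.back hM hN hfin b
      exact (ih h1 h2 _ _ (snoc_mem h3 hc)).1 (h c.1)
    · intro h a
      obtain ⟨q, h1, h2, h3, c, hc, rfl⟩ := hp.forth hM hN hfin a
      exact (ih h1 h2 _ _ (snoc_mem h3 hc)).2 (h c.2)

end IsPartialIso

/-- All generic ranked orders satisfy the same sentences. -/
theorem IsGeneric.models_iff (hM : IsGeneric M) (hN : IsGeneric N) (ψ : Sentence rankedLanguage) :
    Models M ψ ↔ Models N ψ :=
  IsPartialIso.empty.realize_iff hM hN ψ Set.finite_empty _ _ fun i => i.elim0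

/-! ### Construction of models of type `(κ⁺, κ)`. -/

section Combinatorics

open Order

/-- A linear order without endpoints of any infinite size, coloured so that every colour is dense. -/
theorem exists_densely_colored_order (K : Type u) [Infinite K] :
    ∃ (D : Type u) (_ : LinearOrder D) (col : D → K), NoMinOrder D ∧ NoMaxOrder D ∧ Nonempty D ∧
      #D = #K ∧ ∀ a b, a < b → ∀ c, ∃ d, a < d ∧ d < b ∧ col d = c := by
  classical
  obtain ⟨k₀⟩ : Nonempty K := inferInstance
  let : LinearOrder K := IsWellOrder.linearOrder WellOrderingRel
  -- The order consists of the finitely supported sequences in `ℤ ×ₗ K`, ordered lexicographically;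
  -- the colour is the `K`-component of the entry at the supremum of the support. The factor `ℤ`
  -- supplies entries below any given one, and entries above zero of every colour.
  let : Zero (ℤ ×ₗ K) := ⟨toLex (0, k₀)⟩
  have hpos (c : K) : (0 : ℤ ×ₗ K) < toLex (1, c) := Prod.Lex.toLex_lt_toLex.2 (Or.inl one_pos)
  have above (a : ℕ →₀ ℤ ×ₗ K) (i : ℕ) (c : K) : ∃ N, i < N ∧
      (∀ k < N, a k = a.update N (toLex (1, c)) k) ∧ a N < a.update N (toLex (1, c)) N ∧
      (a.update N (toLex (1, c))).support.sup id = N := by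
    refine ⟨max i (a.support.sup id) + 1, by omega, fun k hk => ?_, ?_, ?_⟩
    · rw [Finsupp.update_apply, if_neg hk.ne]
    · have : a (max i (a.support.sup id) + 1) = 0 := by
        by_contra h
        have := Finset.le_sup (f := id) (Finsupp.mem_support_iff.2 h)
        simp only [id] at this
        omega
      rw [Finsupp.update_apply, if_pos rfl, this]
      exact hpos c
    · rw [Finsupp.support_update_ne_zero _ _ (hpos c).ne', Finset.sup_insert, id]
      exact sup_eq_left.2 (by omega)
  -- If `a < b` first differ at `i`, put `(1, c)` into `a` beyond `i` and beyond its support. The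
  -- result exceeds `a`, stays below `b`, and its last nonzero entry has colour `c`.
  have between (a b : Lex (ℕ →₀ ℤ ×ₗ K)) (hab : a < b) (c : K) : ∃ d, a < d ∧ d < b ∧
      (ofLex (ofLex d (Finset.sup (ofLex d).support id))).2 = c := by
    obtain ⟨i, h1, h2⟩ := Finsupp.Lex.lt_iff.1 hab
    obtain ⟨N, hN, hlt, hN', hs⟩ := above (ofLex a) i c
    refine ⟨toLex ((ofLex a).update N (toLex (1, c))), Finsupp.Lex.lt_iff.2 ⟨N, hlt, hN'⟩,
      Finsupp.Lex.lt_iff.2 ⟨i, fun k hk => ?_, ?_⟩, ?_⟩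
    · exact (hlt k (hk.trans hN)).symm.trans (h1 k hk)
    · exact (hlt i hN).symm.trans_lt h2
    · change (ofLex ((ofLex a).update N (toLex (1, c))
        (((ofLex a).update N (toLex (1, c))).support.sup id))).2 = c
      rw [hs, Finsupp.update_apply, if_pos rfl]
      rfl
  refine ⟨Lex (ℕ →₀ ℤ ×ₗ K), inferInstance,
    fun d => (ofLex (ofLex d (Finset.sup (ofLex d).support id))).2, ⟨fun a => ?_⟩,
    ⟨fun a => ?_⟩, ⟨toLex 0⟩, ?_, between⟩
  · obtain ⟨s, hs⟩ : ∃ s, s < ofLex a 0 := ⟨toLex ((ofLex (ofLex a 0)).1 - 1, k₀),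
      Prod.Lex.toLex_lt_toLex.2 (Or.inl (sub_one_lt _))⟩
    refine ⟨toLex ((ofLex a).update 0 s), Finsupp.Lex.lt_iff.2 ⟨0, fun k hk => (by omega), ?_⟩⟩
    change (ofLex a).update 0 s 0 < _
    rwa [Finsupp.update_apply, if_pos rfl]
  · obtain ⟨N, -, hlt, hN', -⟩ := above (ofLex a) 0 k₀
    exact ⟨toLex ((ofLex a).update N (toLex (1, k₀))), Finsupp.Lex.lt_iff.2 ⟨N, hlt, hN'⟩⟩
  · have hK : ℵ₀ ≤ #K := aleph0_le_mk K
    have hS : #(ℤ ×ₗ K) = #K := by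
      change #(ℤ × K) = #K
      rw [mk_prod, mk_int, lift_aleph0, lift_uzero, aleph0_mul_eq hK]
    have : Infinite (ℤ ×ₗ K) := by rw [infinite_iff, hS]; exact hK
    change #(ℕ →₀ ℤ ×ₗ K) = #K
    rw [mk_finsupp_lift_of_infinite', hS, lift_uzero, mk_nat, lift_aleph0, max_eq_right hK]

theorem exists_subset_range {K Y : Type u} [Nonempty Y] {S : Set Y} (h : #S ≤ #K) :
    ∃ e : K → Y, S ⊆ Set.range e := by
  obtain ⟨f⟩ := h
  obtain ⟨y⟩ := ‹Nonempty Y›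
  exact ⟨Function.extend f Subtype.val fun _ => y,
    fun s hs => ⟨f ⟨s, hs⟩, f.injective.extend_apply _ _ ⟨s, hs⟩⟩⟩

/-- A linear order of size `|K|⁺` in which every initial segment is enumerated by `K`, with a
colouring in which every colour is dense; the enumeration is constant on large pieces. -/
theorem exists_succ_like_colored_order (K : Type u) [Infinite K] :
    ∃ (Y : Type u) (_ : LinearOrder Y) (col : Y → K) (E : Y → K → Y), NoMinOrder Y ∧
      NoMaxOrder Y ∧ Nonempty Y ∧ #Y = succ #K ∧ (∀ y, Set.Iic y ⊆ Set.range (E y)) ∧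
      ∀ a b, a < b → ∀ c, ∃ d, a < d ∧ d < b ∧ E d = E a ∧ col d = c := by
  obtain ⟨D, _, col, _, _, _, hD, hcol⟩ := exists_densely_colored_order K
  have hK : ℵ₀ ≤ #K := aleph0_le_mk K
  have hK' : ℵ₀ ≤ succ #K := hK.trans (le_succ _)
  let I := (succ #K).ord.ToType
  have hI : #I = succ #K := mk_ord_toType _
  have : Nonempty I := by
    rw [← mk_ne_zero_iff, hI]
    exact (succ_pos _).ne'
  have hIic (i : I) : #(Set.Iic i) ≤ #K := by
    rw [← Set.Iio_insert]
    refine (mk_insert_le).trans (add_le_of_le hK ?_ (one_le_aleph0.trans hK))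
    exact lt_succ_iff.1 ((mk_Iio_lt i (by rw [hI, Ordinal.type_toType])).trans_eq hI)
  have hlevel (i : I) : #{z : I ×ₗ D | (ofLex z).1 ≤ i} ≤ #K := by
    let f : {z : I ×ₗ D | (ofLex z).1 ≤ i} → Set.Iic i × D :=
      fun z => (⟨(ofLex z.1).1, z.2⟩, (ofLex z.1).2)
    have hf : Function.Injective f := fun z w h => by
      have h1 : (ofLex z.1).1 = (ofLex w.1).1 := congrArg (fun p => p.1.1) h
      have h2 : (ofLex z.1).2 = (ofLex w.1).2 := congrArg (fun p => p.2) h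
      exact Subtype.ext (ofLex.injective (Prod.ext h1 h2))
    refine (mk_le_of_injective hf).trans ?_
    rw [mk_prod, lift_id, lift_id, hD]
    exact mul_le_of_le hK (hIic i) le_rfl
  have : Nonempty (I ×ₗ D) := inferInstanceAs (Nonempty (I × D))
  -- The enumeration depends only on the first coordinate, and it covers that whole column of `I ×ₗ
  -- D` with all earlier ones.
  choose e he using fun i => exists_subset_range (hlevel i)
  refine ⟨I ×ₗ D, inferInstance, fun y => col (ofLex y).2, fun y => e (ofLex y).1, inferInstance,
    inferInstance, inferInstance, ?_, fun y z hz => he _ (Prod.Lex.monotone_fst z y hz), ?_⟩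
  · change #(I × D) = _
    rw [mk_prod, lift_id, lift_id, hI, hD]
    exact mul_eq_left hK' (le_succ _) (aleph0_pos.trans_le hK).ne'
  · intro a b hab c
    -- The point `d` is sought in the column of `a`, where the enumeration does not change.
    have mk {d' : D} (h : (ofLex a).2 < d') (h' : ∀ d < d', toLex ((ofLex a).1, d) < b) :
        ∃ d, a < d ∧ d < b ∧ e (ofLex d).1 = e (ofLex a).1 ∧ col (ofLex d).2 = c := by
      obtain ⟨d, h1, h2, h3⟩ := hcol _ _ h c
      exact ⟨toLex ((ofLex a).1, d), Prod.Lex.lt_iff.2 (Or.inr ⟨rfl, h1⟩), h' d h2, rfl, h3⟩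
    rcases Prod.Lex.lt_iff.1 hab with h | ⟨h, h'⟩
    · obtain ⟨d', hd'⟩ := exists_gt (ofLex a).2
      exact mk hd' fun d _ => Prod.Lex.lt_iff.2 (Or.inl h)
    · exact mk h' fun d hd => Prod.Lex.lt_iff.2 (Or.inr ⟨h, hd⟩)

/-- Engelking–Karłowicz: a large independent family of functions. -/
theorem exists_independent_family (K Y : Type u) [Infinite K] (hY : #Y ≤ 2 ^ #K) :
    ∃ (X : Type u) (h : Y → X → K), #X = #K ∧
      ∀ (Y₀ : Set Y) (g : Y → K), Y₀.Finite → {x | ∀ y ∈ Y₀, h y x = g y}.Infinite := by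
  classical
  obtain ⟨k₀⟩ : Nonempty K := inferInstance
  let : Zero K := ⟨k₀⟩
  have hK : ℵ₀ ≤ #K := aleph0_le_mk K
  rw [← mk_set] at hY
  obtain ⟨A⟩ := hY
  -- The sets `A y` are distinct subsets of `K`. A point `(n, s, t)` evaluates `y` by applying the
  -- table `t` to the trace of `A y` on `s`; the idle `n` makes solution sets infinite.
  refine ⟨ℕ × Finset K × (Finset K →₀ K), fun y x => x.2.2 (x.2.1.filter (· ∈ A y)), ?_,
    fun Y₀ g hY₀ => ?_⟩
  · simp [mk_prod, mk_finset_of_infinite, hK]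
  · have hsep (p : Y × Y) : ∃ k, p.1 ≠ p.2 → ¬ (k ∈ A p.1 ↔ k ∈ A p.2) := by
      by_cases hp : p.1 = p.2
      · exact ⟨k₀, fun h => (h hp).elim⟩
      · by_contra! h
        exact hp (A.injective (Set.ext fun k => (h k).2))
    choose k hk using hsep
    -- With one separating element for each pair from `Y₀`, the traces on `s` are distinct, so a
    -- table can assign their values freely.
    set s : Finset K := (hY₀.toFinset ×ˢ hY₀.toFinset).image k
    have hs {y z : Y} (hy : y ∈ Y₀) (hz : z ∈ Y₀)
        (h : s.filter (· ∈ A y) = s.filter (· ∈ A z)) : y = z := by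
      by_contra hyz
      have hks : k (y, z) ∈ s := Finset.mem_image_of_mem k (by simp [hy, hz])
      have := Finset.ext_iff.1 h (k (y, z))
      simp only [Finset.mem_filter, hks, true_and] at this
      exact hk (y, z) hyz this
    obtain ⟨t, ht⟩ : ∃ t : Finset K →₀ K, ∀ y ∈ Y₀, t (s.filter (· ∈ A y)) = g y := by
      let F : Finset K → K := fun u =>
        if hu : ∃ y ∈ Y₀, s.filter (· ∈ A y) = u then g hu.choose else 0
      refine ⟨Finsupp.onFinset (hY₀.toFinset.image fun y => s.filter (· ∈ A y)) F
        fun u hu => ?_, fun y hy => ?_⟩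
      · by_contra hu'
        refine hu (dif_neg ?_)
        rintro ⟨y, hy, rfl⟩
        exact hu' (Finset.mem_image_of_mem _ (by simpa using hy))
      · have hex : ∃ z ∈ Y₀, s.filter (· ∈ A z) = s.filter (· ∈ A y) := ⟨y, hy, rfl⟩
        rw [Finsupp.onFinset_apply]
        simp only [F, dif_pos hex]
        rw [hs hex.choose_spec.1 hy hex.choose_spec.2]
    refine Set.infinite_of_injective_forall_mem (f := fun n : ℕ => (n, s, t))
      (fun m n h => congrArg Prod.fst h) fun n y hy => ht y hy

/-- The combinatorial core of generic ranked orders of type `(κ⁺, κ)`. -/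
theorem exists_generic_functions (κ : Cardinal.{u}) (hκ : ℵ₀ ≤ κ) :
    ∃ (X Y : Type u) (_ : LinearOrder Y) (rk : Y → ℕ) (F : Y → X → Y),
      Nonempty Y ∧ #X = κ ∧ #Y = succ κ ∧
      (∀ y n x, rk y = n + 1 → F y x < y ∧ rk (F y x) = n) ∧
      (∀ (n : ℕ) (S T : Set Y) (G : Set (X × Y)), S.Finite → T.Finite → G.Finite →
        (∀ a ∈ S, ∀ b ∈ T, a < b) → (∀ g ∈ G, g.2 ∈ S ∧ n = rk g.2 + 1) →
        (∀ g ∈ G, ∀ h ∈ G, g.1 = h.1 → g.2 = h.2) →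
        ∃ y, rk y = n ∧ (∀ a ∈ S, a < y) ∧ (∀ b ∈ T, y < b) ∧ ∀ g ∈ G, F y g.1 = g.2) ∧
      (∀ (S : Set X) (G : Set (Y × Y)), S.Finite → G.Finite →
        (∀ g ∈ G, g.2 < g.1 ∧ rk g.1 = rk g.2 + 1) →
        (∀ g ∈ G, ∀ h ∈ G, g.1 = h.1 → g.2 = h.2) →
        ∃ x, x ∉ S ∧ ∀ g ∈ G, F g.1 x = g.2) := by
  classical
  obtain ⟨K, rfl⟩ : ∃ K : Type u, #K = κ := ⟨_, mk_out κ⟩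
  have : Infinite K := infinite_iff.2 hκ
  obtain ⟨Y, _, col, E, _, _, _, hY, hE, hcol⟩ := exists_succ_like_colored_order K
  obtain ⟨X, h, hX, hind⟩ := exists_independent_family K Y (hY ▸ succ_le_of_lt (cantor _))
  have : Nonempty X := mk_ne_zero_iff.1 (hX ▸ (aleph0_pos.trans_le hκ).ne')
  obtain ⟨dec, hdec⟩ : ∃ dec : K → ℕ × List (X × K), Function.Surjective dec := by
    have : #(ℕ × List (X × K)) = #K := by
      simp [mk_prod, mk_list_eq_mk, hX, hκ]
    obtain ⟨e⟩ := Cardinal.eq.1 this.symm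
    exact ⟨e, e.surjective⟩
  have : DenselyOrdered Y := ⟨fun a b hab => by
    obtain ⟨k⟩ : Nonempty K := inferInstance
    obtain ⟨d, h1, h2, -⟩ := hcol a b hab k
    exact ⟨d, h1, h2⟩⟩
  let rk (y : Y) : ℕ := (dec (col y)).1
  let code (y : Y) : List (X × K) := (dec (col y)).2
  -- A value is admissible if it is below `y` and of rank one less. The code of `y` has priority at
  -- the finitely many `x` it mentions, `E y (h y x)` is used at the others, and an inadmissible
  -- proposal is replaced by any admissible value, if there is one.
  have hF (y : Y) (x : X) : ∃ z,
      ((∃ w, w < y ∧ rk y = rk w + 1) → z < y ∧ rk y = rk z + 1) ∧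
      (∀ w, w < y → rk y = rk w + 1 → (∃ k, (x, k) ∈ code y) →
        (∀ k, (x, k) ∈ code y → E y k = w) → z = w) ∧
      (E y (h y x) < y → rk y = rk (E y (h y x)) + 1 → (∀ k, (x, k) ∉ code y) →
        z = E y (h y x)) := by
    by_cases hx : ∃ k, (x, k) ∈ code y
    · obtain ⟨k, hk⟩ := hx
      by_cases hw : E y k < y ∧ rk y = rk (E y k) + 1
      · exact ⟨E y k, fun _ => hw, fun w _ _ _ h => h k hk, fun _ _ h => (h k hk).elim⟩
      · by_cases hw' : ∃ w, w < y ∧ rk y = rk w + 1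
        · exact ⟨hw'.choose, fun _ => hw'.choose_spec,
            fun w h1 h2 _ h3 => (hw (by rw [h3 k hk]; exact ⟨h1, h2⟩)).elim,
            fun _ _ h => (h k hk).elim⟩
        · exact ⟨y, fun h => (hw' h).elim, fun w h1 h2 => (hw' ⟨w, h1, h2⟩).elim,
            fun _ _ h => (h k hk).elim⟩
    · by_cases hw : E y (h y x) < y ∧ rk y = rk (E y (h y x)) + 1
      · exact ⟨_, fun _ => hw, fun _ _ _ h => (hx h).elim, fun _ _ _ => rfl⟩
      · by_cases hw' : ∃ w, w < y ∧ rk y = rk w + 1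
        · exact ⟨hw'.choose, fun _ => hw'.choose_spec, fun _ _ _ h => (hx h).elim,
            fun h1 h2 => (hw ⟨h1, h2⟩).elim⟩
        · exact ⟨y, fun h => (hw' h).elim, fun _ _ _ h => (hx h).elim,
            fun h1 h2 => (hw' ⟨_, h1, h2⟩).elim⟩
  choose F hF1 hF2 hF3 using hF
  refine ⟨X, Y, inferInstance, rk, F, inferInstance, hX, hY, ?_, ?_, ?_⟩
  · intro y n x hy
    -- An admissible value exists: the colours of rank `n` occur in every interval, and `Y` has no
    -- least element.
    obtain ⟨a, ha⟩ := exists_lt y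
    obtain ⟨c, hc⟩ := hdec (n, [])
    obtain ⟨d, -, hd, -, hd'⟩ := hcol a y ha c
    have hdn : rk d = n := by simp [rk, hd', hc]
    have := hF1 y x ⟨d, hd, by rw [hy, hdn]⟩
    exact ⟨this.1, by omega⟩
  · intro n S T G hS hT hG hST hGS hfun
    -- The code must be written before `y` is known. It is written with indices for `E a`, where `a`
    -- lies above `S` and below `T`; then `y` is found just above `a` with `E y = E a`, so it
    -- decodes correctly. The point `b` keeps `y` below `T`.
    obtain ⟨a, ha, ha'⟩ := exists_between_finsets hS.toFinset hT.toFinset (by simpa using hST)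
    simp only [Set.Finite.mem_toFinset] at ha ha'
    obtain ⟨b, hb, hb'⟩ := exists_between_finsets {a} hT.toFinset (by simpa using ha')
    simp only [Set.Finite.mem_toFinset, Finset.mem_singleton, forall_eq] at hb hb'
    have hk (z : Y) : ∃ k, z ≤ a → E a k = z := by
      by_cases hz : z ≤ a
      · obtain ⟨k, hk⟩ := hE a hz
        exact ⟨k, fun _ => hk⟩
      · exact ⟨Classical.arbitrary K, fun h => (hz h).elim⟩
    choose k hk using hk
    obtain ⟨c, hc⟩ := hdec (n, (hG.toFinset.image fun g => (g.1, k g.2)).toList)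
    obtain ⟨y, h1, h2, h3, h4⟩ := hcol a b hb c
    have hyn : rk y = n := by simp [rk, h4, hc]
    have hcode (x : X) (i : K) : (x, i) ∈ code y ↔ ∃ g ∈ G, g.1 = x ∧ k g.2 = i := by
      simp [code, h4, hc]
    refine ⟨y, hyn, fun s hs => (ha s hs).trans h1, fun t ht => h2.trans (hb' t ht),
      fun g hg => ?_⟩
    have hga : g.2 < a := ha _ (hGS g hg).1
    refine hF2 y g.1 g.2 (hga.trans h1) (hyn.trans (hGS g hg).2)
      ⟨k g.2, (hcode _ _).2 ⟨g, hg, rfl, rfl⟩⟩ fun i hi => ?_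
    obtain ⟨g', hg', h5, rfl⟩ := (hcode _ _).1 hi
    rw [hfun g' hg' g hg h5, h3, hk _ hga.le]
  · intro S G hS hG hGlt hfun
    have hk (y : Y) : ∃ i, ∀ z, (y, z) ∈ G → E y i = z := by
      by_cases hy : ∃ z, (y, z) ∈ G
      · obtain ⟨z, hz⟩ := hy
        obtain ⟨i, hi⟩ := hE y (hGlt _ hz).1.le
        exact ⟨i, fun w hw => hi.trans (hfun _ hz _ hw rfl)⟩
      · exact ⟨Classical.arbitrary K, fun z hz => (hy ⟨z, hz⟩).elim⟩
    choose i hi using hk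
    -- Only finitely many `x` are excluded or mentioned in the relevant codes. Independence gives
    -- infinitely many `x` with the required indices, so one of them avoids these.
    have hfin : (S ∪ ⋃ g ∈ G, {x | ∃ j, (x, j) ∈ code g.1}).Finite := by
      refine hS.union (hG.biUnion fun g _ => ?_)
      refine ((code g.1).toFinset.image Prod.fst).finite_toSet.subset ?_
      rintro x ⟨j, hj⟩
      simpa using ⟨j, hj⟩
    obtain ⟨x, hx, hx'⟩ := ((hind (Prod.fst '' G) i (hG.image _)).sdiff hfin).nonempty
    refine ⟨x, fun h => hx' (Or.inl h), fun g hg => ?_⟩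
    have hEg : E g.1 (h g.1 x) = g.2 := by
      rw [hx g.1 ⟨g, hg, rfl⟩]
      exact hi _ _ hg
    rw [hF3 g.1 x (hEg ▸ (hGlt g hg).1) (hEg ▸ (hGlt g hg).2)
      fun j hj => hx' (Or.inr (Set.mem_biUnion hg ⟨j, hj⟩)), hEg]

end Combinatorics

/-! ### From functions to structures. -/

/-- The ranked order on `X ⊕ Y` given by a rank function and a function `F`. -/
abbrev sumStructure {X Y : Type u} [LinearOrder Y] (rk : Y → ℕ) (F : Y → X → Y) :
    rankedLanguage.Structure (X ⊕ Y) where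
  funMap f := f.elim
  RelMap
    | .X, v => ∃ x, v 0 = .inl x
    | .Y, v => ∃ y, v 0 = .inr y
    | .P n, v => ∃ y, v 0 = .inr y ∧ rk y = n
    | .lt, v => ∃ a b, v 0 = .inr a ∧ v 1 = .inr b ∧ a < b
    -- `F` is total, but its values at rank `0` are meaningless and are discarded.
    | .R, v => ∃ y x, v 0 = .inr y ∧ v 1 = .inl x ∧ v 2 = .inr (F y x) ∧ rk y ≠ 0

section SumStructure

variable {X Y : Type u} [LinearOrder Y] (rk : Y → ℕ) (F : Y → X → Y)

theorem isGeneric_sumStructure [Nonempty Y]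
    (hF : ∀ y n x, rk y = n + 1 → F y x < y ∧ rk (F y x) = n)
    (hY : ∀ (n : ℕ) (S T : Set Y) (G : Set (X × Y)), S.Finite → T.Finite → G.Finite →
      (∀ a ∈ S, ∀ b ∈ T, a < b) → (∀ g ∈ G, g.2 ∈ S ∧ n = rk g.2 + 1) →
      (∀ g ∈ G, ∀ h ∈ G, g.1 = h.1 → g.2 = h.2) →
      ∃ y, rk y = n ∧ (∀ a ∈ S, a < y) ∧ (∀ b ∈ T, y < b) ∧ ∀ g ∈ G, F y g.1 = g.2)
    (hX : ∀ (S : Set X) (G : Set (Y × Y)), S.Finite → G.Finite →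
      (∀ g ∈ G, g.2 < g.1 ∧ rk g.1 = rk g.2 + 1) →
      (∀ g ∈ G, ∀ h ∈ G, g.1 = h.1 → g.2 = h.2) → ∃ x, x ∉ S ∧ ∀ g ∈ G, F g.1 x = g.2) :
    @IsGeneric (X ⊕ Y) (sumStructure rk F) := by
  let := sumStructure rk F
  have iX (a : X ⊕ Y) : IsX a ↔ ∃ x, a = .inl x := Iff.rfl
  have iY (a : X ⊕ Y) : IsY a ↔ ∃ y, a = .inr y := Iff.rfl
  have iP (n : ℕ) (a : X ⊕ Y) : HasRank n a ↔ ∃ y, a = .inr y ∧ rk y = n := Iff.rfl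
  have iB (a b : X ⊕ Y) : Below a b ↔ ∃ c d, a = .inr c ∧ b = .inr d ∧ c < d := Iff.rfl
  have iM (a b c : X ⊕ Y) : Maps a b c ↔
      ∃ y x, a = .inr y ∧ b = .inl x ∧ c = .inr (F y x) ∧ rk y ≠ 0 := Iff.rfl
  have hF' (y : Y) (x : X) (h : rk y ≠ 0) : F y x < y ∧ rk y = rk (F y x) + 1 := by
    obtain ⟨n, hn⟩ := Nat.exists_eq_succ_of_ne_zero h
    have := hF y n x hn
    exact ⟨this.1, by omega⟩
  refine
    { isX_or_isY := fun a => by cases a <;> simp [iX, iY]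
      not_isY := fun {a} => by cases a <;> simp [iX, iY]
      isY_of_hasRank := fun {n a} => by cases a <;> simp [iY, iP]
      exists_hasRank := fun {a} => by cases a <;> simp [iY, iP]
      hasRank_unique := fun {m n a} => by cases a <;> simp +contextual [iP]
      isY_of_below := fun {a b} => by cases a <;> cases b <;> simp [iY, iB]
      irrefl := fun a => by cases a <;> simp [iB]
      trans := ?_
      total := fun {a b} => by
        cases a <;> cases b <;> simp [iY, iB]
        exact lt_trichotomy _ _
      isX_of_maps := fun {y x z} => by rintro ⟨y, x, rfl, rfl, rfl, -⟩; exact ⟨x, rfl⟩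
      below_of_maps := fun {y x z} => by
        rintro ⟨y, x, rfl, rfl, rfl, h⟩; exact ⟨_, _, rfl, rfl, (hF' y x h).1⟩
      hasRank_of_maps := fun {n y x z} => by
        rintro ⟨y, x, rfl, rfl, rfl, h⟩
        change (∃ _, _) ↔ ∃ _, _
        have := (hF' y x h).2
        simp [this]
      not_hasRank_zero := fun {y x z} => by
        rintro ⟨y, x, rfl, rfl, rfl, h⟩
        simpa [iP] using h
      exists_maps := fun {n y x} => by
        rintro ⟨y, rfl, hy⟩ ⟨x, rfl⟩
        exact ⟨.inr (F y x), y, x, rfl, rfl, rfl, by simp [hy]⟩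
      maps_unique := fun {y x z w} => by
        rintro ⟨y, x, rfl, rfl, rfl, -⟩ ⟨y', x', h1, h2, rfl, -⟩
        cases h1
        cases h2
        rfl
      extend_Y := fun n S T G hS hT hG h1 h2 h3 h4 h5 => ?_
      extend_X := fun S G hS hG h1 h2 => ?_ }
  · rintro a b c ⟨a, b, rfl, rfl, hab⟩ ⟨b', c, hb, rfl, hbc⟩
    cases hb
    exact ⟨a, c, rfl, rfl, hab.trans hbc⟩
  · obtain ⟨y, hy, hyS, hyT, hyG⟩ := hY n (Sum.inr ⁻¹' S) (Sum.inr ⁻¹' T)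
      (Prod.map Sum.inl Sum.inr ⁻¹' G) (hS.preimage Sum.inr_injective.injOn)
      (hT.preimage Sum.inr_injective.injOn)
      (hG.preimage (Sum.inl_injective.prodMap Sum.inr_injective).injOn)
      (fun a ha b hb => by simpa [iB] using h3 _ ha _ hb)
      (fun g hg => by
        obtain ⟨-, h, m, rfl, hm⟩ := h4 _ hg
        have hm : rk g.2 = m := by simpa [iP] using hm
        exact ⟨h, by rw [hm]⟩)
      (fun g hg h hh hgh => Sum.inr_injective (h5 _ hg _ hh (congrArg Sum.inl hgh)))
    refine ⟨.inr y, ⟨y, rfl, hy⟩, fun a ha => ?_, fun b hb => ?_, fun g hg => ?_⟩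
    · obtain ⟨a, rfl⟩ := h1 a ha
      exact ⟨a, y, rfl, rfl, hyS a ha⟩
    · obtain ⟨b, rfl⟩ := h2 b hb
      exact ⟨y, b, rfl, rfl, hyT b hb⟩
    · obtain ⟨g1, g2⟩ := g
      obtain ⟨⟨x, rfl⟩, -, m, rfl, z, rfl, -⟩ := h4 _ hg
      exact ⟨y, x, rfl, rfl, congrArg Sum.inr (hyG (x, z) hg).symm, by simp [hy]⟩
  · obtain ⟨x, hxS, hxG⟩ := hX (Sum.inl ⁻¹' S) (Prod.map Sum.inr Sum.inr ⁻¹' G)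
      (hS.preimage Sum.inl_injective.injOn)
      (hG.preimage (Sum.inr_injective.prodMap Sum.inr_injective).injOn)
      (fun g hg => by
        obtain ⟨h, m, h', h''⟩ := h1 _ hg
        refine ⟨by simpa [iB] using h, ?_⟩
        have h' : rk g.1 = m + 1 := by simpa [iP] using h'
        have h'' : rk g.2 = m := by simpa [iP] using h''
        omega)
      (fun g hg h hh hgh => Sum.inr_injective (h2 _ hg _ hh (congrArg Sum.inr hgh)))
    refine ⟨.inl x, ⟨x, rfl⟩, hxS, fun g hg => ?_⟩
    obtain ⟨g1, g2⟩ := g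
    obtain ⟨-, m, ⟨y, rfl, hy⟩, z, rfl, -⟩ := h1 _ hg
    exact ⟨y, x, rfl, rfl, congrArg Sum.inr (hxG (y, z) hg).symm, by simp [hy]⟩

end SumStructure

theorem exists_isGeneric (κ : Cardinal.{u}) (hκ : ℵ₀ ≤ κ) :
    ∃ (M : Type u) (_ : rankedLanguage.Structure M), Nonempty M ∧ IsGeneric M ∧
      #M = Order.succ κ ∧ #{a : M | IsX a} = κ := by
  obtain ⟨X, Y, _, rk, F, _, hX, hY, h1, h2, h3⟩ := exists_generic_functions κ hκ
  refine ⟨X ⊕ Y, sumStructure rk F, inferInstance, isGeneric_sumStructure rk F h1 h2 h3, ?_, ?_⟩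
  · rw [mk_sum, lift_id, lift_id, hX, hY]
    exact add_eq_right (hκ.trans (Order.le_succ κ)) (Order.le_succ κ)
  · rw [← hX, ← mk_range_eq (Sum.inl : X → X ⊕ Y) Sum.inl_injective]
    congr 2
    ext a
    exact exists_congr fun x => eq_comm

/-! ### The cardinality bound. -/

/-- A linear order whose initial segments have size at most `κ` has size at most `κ⁺`. -/
theorem mk_le_succ_of_forall_mk_Iio_le {Y : Type u} [LinearOrder Y] {κ : Cardinal.{u}} (hκ : ℵ₀ ≤ κ)
    (h : ∀ y : Y, #(Set.Iio y) ≤ κ) : #Y ≤ Order.succ κ := by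
  by_contra! hlt
  -- A subset of size `κ⁺` is cofinal, because a strict upper bound would have more than `κ`
  -- predecessors. So `Y` is covered by this set and `κ⁺` segments of size at most `κ`.
  obtain ⟨S, hS⟩ := le_mk_iff_exists_set.1 hlt.le
  have hcof (y : Y) : ∃ s ∈ S, y ≤ s := by
    by_contra! hy
    have := (mk_le_mk_of_subset (t := Set.Iio y) hy).trans (h y)
    rw [hS] at this
    exact this.not_gt (Order.lt_succ κ)
  have hU : (Set.univ : Set Y) ⊆ S ∪ ⋃ s : S, Set.Iio (s : Y) := by
    intro y _
    obtain ⟨s, hs, hys⟩ := hcof y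
    rcases hys.eq_or_lt with rfl | hys
    · exact Or.inl hs
    · exact Or.inr (Set.mem_iUnion.2 ⟨⟨s, hs⟩, hys⟩)
  have hκ' : ℵ₀ ≤ Order.succ κ := hκ.trans (Order.le_succ κ)
  refine hlt.not_ge ?_
  rw [← mk_univ]
  refine (mk_le_mk_of_subset hU).trans ((mk_union_le _ _).trans (add_le_of_le hκ' hS.le ?_))
  refine (mk_iUnion_le _).trans (mul_le_of_le hκ' hS.le ?_)
  exact ciSup_le' fun s => (h s).trans (Order.le_succ κ)

namespace IsGeneric

variable {M : Type u} [rankedLanguage.Structure M]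

theorem isCompl (hM : IsGeneric M) : IsCompl {a : M | IsX a} {a : M | IsY a} :=
  ⟨Set.disjoint_left.2 fun _ h => hM.not_isY h, codisjoint_iff_le_sup.2 fun a _ => hM.isX_or_isY a⟩

theorem isStrictTotalOrder (hM : IsGeneric M) :
    IsStrictTotalOrder {a : M | IsY a} fun a b => Below (a : M) (b : M) where
  irrefl a := hM.irrefl a.1
  trans _ _ _ := hM.trans
  trichotomous a b h h' := by
    rcases hM.total a.2 b.2 with h'' | h'' | h''
    exacts [(h h'').elim, Subtype.ext h'', (h' h'').elim]

theorem infinite_isX (hM : IsGeneric M) : {a : M | IsX a}.Infinite := fun hfin => by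
  obtain ⟨x, hx, hx', -⟩ := hM.extend_X _ ∅ hfin Set.finite_empty (by simp) (by simp)
  exact hx' hx

/-- For each `n` some `w` above `y` has rank `n + 1`, and every element of rank `n` below `y` is the
value of `w` at some `x`. This injects each rank below `y` into `X`, and there are countably many
ranks. -/
theorem mk_below_le (hM : IsGeneric M) {y : M} (hy : IsY y) :
    #{a : M | Below a y} ≤ #{a : M | IsX a} := by
  have hinf : ℵ₀ ≤ #{a : M | IsX a} := infinite_iff.1 hM.infinite_isX.to_subtype
  have hn (n : ℕ) : #{a : M | Below a y ∧ HasRank n a} ≤ #{a : M | IsX a} := by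
    obtain ⟨w, hw, hyw, -⟩ := hM.extend_Y (n + 1) {y} ∅ ∅ (Set.finite_singleton y) Set.finite_empty
      Set.finite_empty (by simpa using hy) (by simp) (by simp) (by simp) (by simp)
    have hex (a : {a : M | Below a y ∧ HasRank n a}) : ∃ x, Maps w x a.1 := by
      obtain ⟨x, -, -, hx⟩ := hM.extend_X ∅ {(w, a.1)} Set.finite_empty (Set.finite_singleton _)
        (by simpa using ⟨hM.trans a.2.1 (hyw y rfl), n, hw, a.2.2⟩) (by simp)
      exact ⟨x, hx _ rfl⟩
    choose x hx using hex
    refine mk_le_of_injective (f := fun a => ⟨x a, hM.isX_of_maps (hx a)⟩) fun a b hab => ?_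
    have hab : x a = x b := congrArg Subtype.val hab
    exact Subtype.ext (hM.maps_unique (hx a) (hab ▸ hx b))
  have hU : {a : M | Below a y} ⊆ ⋃ n : ULift.{u} ℕ, {a : M | Below a y ∧ HasRank n.down a} := by
    intro a ha
    obtain ⟨n, hn⟩ := hM.exists_hasRank (hM.isY_of_below ha).1
    exact Set.mem_iUnion.2 ⟨⟨n⟩, ha, hn⟩
  refine (mk_le_mk_of_subset hU).trans ((mk_iUnion_le _).trans (mul_le_of_le hinf ?_ ?_))
  · simpa using hinf
  · exact ciSup_le' fun n => hn n.down

theorem mk_le_succ (hM : IsGeneric M) : #M ≤ Order.succ #{a : M | IsX a} := by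
  classical
  have hinf : ℵ₀ ≤ #{a : M | IsX a} := infinite_iff.1 hM.infinite_isX.to_subtype
  have := hM.isStrictTotalOrder
  let : LinearOrder {a : M | IsY a} :=
    linearOrderOfSTO fun a b : {a : M | IsY a} => Below (a : M) (b : M)
  have hY : #{a : M | IsY a} ≤ Order.succ #{a : M | IsX a} := by
    refine mk_le_succ_of_forall_mk_Iio_le hinf fun y => le_trans ?_ (hM.mk_below_le y.2)
    exact mk_le_of_injective (f := fun a : Set.Iio y => ⟨a.1.1, a.2⟩) fun a b hab =>
      Subtype.ext (Subtype.ext (congrArg (fun z : {z : M | Below z y.1} => z.1) hab))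
  rw [← mk_univ, ← Set.top_eq_univ, ← hM.isCompl.sup_eq_top]
  exact (mk_union_le _ _).trans
    (add_le_of_le (hinf.trans (Order.le_succ _)) (Order.le_succ _) hY)

end IsGeneric

/-- Every sentence is decided by its truth in one fixed generic model, since all generic models
agree. -/
theorem isComplete_genericSentence : IsComplete.{u} Formula.genericSentence := by
  obtain ⟨M, _, hne, hM, -⟩ := exists_isGeneric.{u} ℵ₀ le_rfl
  refine ⟨⟨M, inferInstance, hne, Formula.models_genericSentence.2 hM⟩, fun ψ => ?_⟩
  by_cases h : Models M ψ
  · exact Or.inl fun N _ _ hN => ((Formula.models_genericSentence.1 hN).models_iff hM ψ).2 h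
  · exact Or.inr fun N _ _ hN hψ =>
      h (((Formula.models_genericSentence.1 hN).models_iff hM ψ).1 hψ)

end InfLogic

theorem mainTheorem1 :
    ∃ (L : FirstOrder.Language.{0, 0}) (X Y : L.Relations 1) (lt : L.Relations 2)
      (φ : InfLogic.Sentence L),
      Countable L.Symbols ∧
      InfLogic.IsComplete.{u} φ ∧
      -- `X` and `Y` partition every model, and `<` is a linear order of `Y`
      (∀ (M : Type u) [L.Structure M] [Nonempty M], InfLogic.Models M φ →
        IsCompl (InfLogic.interp X M) (InfLogic.interp Y M) ∧
        IsStrictTotalOrder (InfLogic.interp Y M)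
          (fun a b => FirstOrder.Language.Structure.RelMap lt ![(a : M), (b : M)])) ∧
      -- arbitrarily large models
      (∀ κ : Cardinal.{u}, ∃ (M : Type u) (_ : L.Structure M),
        Nonempty M ∧ InfLogic.Models M φ ∧ κ ≤ Cardinal.mk M) ∧
      -- `|M| ≤ |X^M|⁺`
      (∀ (M : Type u) [L.Structure M] [Nonempty M], InfLogic.Models M φ →
        Cardinal.mk M ≤ Order.succ (Cardinal.mk (InfLogic.interp X M))) ∧
      -- models of type `(κ⁺, κ)`
      (∀ κ : Cardinal.{u}, Cardinal.aleph0 ≤ κ →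
        InfLogic.HasModelOfType φ X (Order.succ κ) κ) := by
  open InfLogic in
  refine ⟨rankedLanguage, .X, .Y, .lt, Formula.genericSentence, countable_symbols_rankedLanguage,
    isComplete_genericSentence, fun M _ _ hM => ?_, fun κ => ?_, fun M _ _ hM => ?_,
    fun κ hκ => ?_⟩
  · have hM := Formula.models_genericSentence.1 hM
    exact ⟨hM.isCompl, hM.isStrictTotalOrder⟩
  · obtain ⟨M, _, hne, hM, hc, -⟩ := exists_isGeneric (max κ ℵ₀) (le_max_right _ _)
    exact ⟨M, inferInstance, hne, Formula.models_genericSentence.2 hM,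
      hc ▸ (le_max_left κ ℵ₀).trans (Order.le_succ _)⟩
  · exact (Formula.models_genericSentence.1 hM).mk_le_succ
  · obtain ⟨M, _, hne, hM, hc, hX⟩ := exists_isGeneric κ hκ
    exact ⟨M, inferInstance, hne, Formula.models_genericSentence.2 hM, hc, hX⟩
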